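/- Let $M$ be a compact connected smooth Riemannian manifold without boundary, with Riemannian volume measure $\mu$, and let $\mathrm{div}$, $\nabla$ and $\langle\cdot,\cdot\rangle$ be its divergence, gradient and metric. Let $\mathfrak D(M)$ be the group of diffeomorphisms of $M$. Its Lie algebra $\mathfrak X(M)$ is the space of smooth vector fields, with adjoint operator $\mathrm{ad}_v w=-[v,w]$, where $[v,w]f=v(wf)-w(vf)$ is the usual bracket. Consider the (degenerate) right-invariant homogeneous $\dot H^1$ metric on $\mathfrak D(M)$, given at the identity by $$\langle v,w\rangle_{\dot H^1}=\tfrac14\int_M \mathrm{div}\,v\cdot\mathrm{div}\,w\,d\mu .$$ Its Euler-Arnold equation is $u_t=-\mathrm{ad}_u^\top u$, where $\mathrm{ad}^\top$ is the transpose of $\mathrm{ad}$ with respect to $\langle\cdot,\cdot\rangle_{\dot H^1}$. Since the metric is degenerate, the equation is understood modulo the kernel of the metric; that is, $$-\langle u_t,w\rangle_{\dot H^1}=\langle u,\mathrm{ad}_u w\rangle_{\dot H^1}\qquad\text{for all } w\in\mathfrak X(M).$$ Let $J\subset\mathbb R$ be a nondegenerate interval, and let $u=u(t,x)$, $t\in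 J$, be a time-dependent vector field on $M$ that is smooth in $(t,x)\in J\times M$ (time derivatives at endpoints of $J$ are one-sided). Then the following are equivalent: 1. $u$ satisfies the Euler-Arnold equation of the $\dot H^1$ metric on $J$; 2. on $J\times M$, $$\nabla\,\mathrm{div}\,u_t+\mathrm{div}\,u\cdot\nabla\,\mathrm{div}\,u+\nabla\langle u,\nabla\,\mathrm{div}\,u\rangle=0;$$ 3. on $J\times M$, with $h=\mathrm{div}\,u$, $$h_t+\langle u,\nabla h\rangle+\tfrac12h^2=-\frac1{2\mu(M)}\int_M h^2\,d\mu .$$ Moreover, this generalizes the Hunter-Saxton equation: if $\dim M=1$, $\gamma:\mathbb R\to M$ is a smooth surjective unit-speed parametrization of $M$ (the quotient map $\mathbb R\to\mathbb R/L\mathbb Z$ for a circle of length $L$), and $f(t,x)=\langle u(t,\gamma(x)),\gamma'(x)\rangle$, then $u$ satisfies the Euler-Arnold equation on $J$ if and only if $$f_{txx}+2f_xf_{xx}+ff_{xxx}=0\qquad\text{on } J\times\mathbb R .$$ -/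

import Mathlib

open Bundle Manifold MeasureTheory Set
open scoped ContDiff Manifold Bundle

noncomputable section

namespace EulerArnold

/-- The model space `ℝⁿ` with its Euclidean structure. -/
abbrev Eucl (n : ℕ) : Type := EuclideanSpace ℝ (Fin n)

variable {n : ℕ} {M : Type*} [TopologicalSpace M] [ChartedSpace (Eucl n) M]

/-- A vector field on `M`, with no regularity. -/
abbrev VField (n : ℕ) (M : Type*) [TopologicalSpace M] [ChartedSpace (Eucl n) M] : Type _ :=
  (x : M) → TangentSpace (𝓡 n) x

/-- Smooth vector fields: the elements of the Lie algebra `T_e 𝔇(M) = C^∞(M, TM)`. -/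
def IsSmoothField [IsManifold (𝓡 n) ∞ M] (v : VField n M) : Prop :=
  ContMDiff (𝓡 n) (𝓡 n).tangent ∞ fun x => (⟨x, v x⟩ : TangentBundle (𝓡 n) M)

/-- The coordinate vector field `∂_i` of the chart around `c`, at the point with coordinates `y`. -/
def coordField (c : M) (i : Fin n) (y : Eucl n) :
    TangentSpace (𝓡 n) ((chartAt (Eucl n) c).symm y) :=
  mfderiv 𝓘(ℝ, Eucl n) (𝓡 n) (chartAt (Eucl n) c).symm y (EuclideanSpace.single i (1 : ℝ))

/-- The `i`-th component `vⁱ(y)` of the vector field `v` in the chart around `c`. -/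
def coordComponent (c : M) (v : VField n M) (i : Fin n) (y : Eucl n) : ℝ :=
  (EuclideanSpace.proj i : Eucl n →L[ℝ] ℝ)
    (mfderiv (𝓡 n) 𝓘(ℝ, Eucl n) (chartAt (Eucl n) c) ((chartAt (Eucl n) c).symm y)
      (v ((chartAt (Eucl n) c).symm y)))

/-- The adjoint operator of the Lie algebra of the group `𝔇(M)`: since `Ad_φ w = φ_* w`, its
derivative at the identity in the direction `v` is `ad_v w = -[v, w]`, where `[v, w]` is the usual
bracket of vector fields, `[v, w] f = v (w f) - w (v f)`. -/
def adj (v w : VField n M) : VField n M :=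
  fun x => -VectorField.mlieBracket (𝓡 n) v w x

/-- The time derivative `u_t`, within the time interval `J`, of a curve of vector fields. -/
def timeDeriv (J : Set ℝ) (u : ℝ → VField n M) (t : ℝ) : VField n M :=
  fun x => derivWithin (fun s => u s x) J t

/-- The curve `t ↦ u t`, `t ∈ J`, of vector fields is smooth, jointly in time and space. -/
def IsSmoothCurve [IsManifold (𝓡 n) ∞ M] (J : Set ℝ) (u : ℝ → VField n M) : Prop :=
  ContMDiffOn (𝓘(ℝ, ℝ).prod (𝓡 n)) (𝓡 n).tangent ∞
    (fun p : ℝ × M => (⟨p.2, u p.1 p.2⟩ : TangentBundle (𝓡 n) M)) (J ×ˢ univ)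

/-- `a` is a value of the transposed operator `ad_v^⊤ u` with respect to the symmetric bilinear form
`B` on smooth vector fields: `B(a, w) = B(u, ad_v w)` for all smooth `w`. If `B` is degenerate, this
determines `a` modulo the kernel of `B`. -/
def IsAdTranspose [IsManifold (𝓡 n) ∞ M] (B : VField n M → VField n M → ℝ)
    (v u a : VField n M) : Prop :=
  ∀ w : VField n M, IsSmoothField w → B a w = B u (adj v w)

/-- The Euler-Arnold equation `u_t = -ad_u^⊤ u` on the time interval `J`, for the right-invariant
metric on `𝔇(M)` given at the identity by `B` (modulo the kernel of `B` if `B` is degenerate). -/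
def EulerArnoldEquation [IsManifold (𝓡 n) ∞ M] (B : VField n M → VField n M → ℝ)
    (J : Set ℝ) (u : ℝ → VField n M) : Prop :=
  ∀ t ∈ J, IsAdTranspose B (u t) (u t) (fun x => -timeDeriv J u t x)

variable [RiemannianBundle (fun x : M => TangentSpace (𝓡 n) x)]

/-- The density `√(det (g_ij))` of the Riemannian volume in the chart around `c`. -/
def sqrtGram (c : M) (y : Eucl n) : ℝ :=
  √(Matrix.of fun i j : Fin n => inner ℝ (coordField c i y) (coordField c j y)).det

/-- The Riemannian volume in the domain of the chart around `c` (and zero outside it): the measure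
`√(det (g_ij)) dy` on the image of the chart, carried to `M`. -/
def chartVolume [MeasurableSpace M] (c : M) : Measure M :=
  (((volume : Measure (Eucl n)).restrict (chartAt (Eucl n) c).target).withDensity
    fun y => ENNReal.ofReal (sqrtGram c y)).map (chartAt (Eucl n) c).symm

/-- The Riemannian volume measure `μ` of `M`. The measures `chartVolume c` agree on the overlaps of
the charts; their least upper bound (in the lattice of measures) is the measure on `M` that
restricts to `chartVolume c` on the domain of each chart. -/
def riemVolume (n : ℕ) (M : Type*) [TopologicalSpace M] [ChartedSpace (Eucl n) M]
    [RiemannianBundle (fun x : M => TangentSpace (𝓡 n) x)] [MeasurableSpace M] : Measure M :=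
  ⨆ c : M, chartVolume (n := n) c

/-- The divergence `div v = (1/√G) ∑ i, ∂_i (√G vⁱ)`, `G = det (g_ij)`, with respect to the Riemannian
volume, at the point `x`; computed in the preferred chart at `x`. -/
def divergence (v : VField n M) (x : M) : ℝ :=
  (sqrtGram x (chartAt (Eucl n) x x))⁻¹ *
    ∑ i : Fin n, fderiv ℝ (fun y => sqrtGram x y * coordComponent x v i y)
      (chartAt (Eucl n) x x) (EuclideanSpace.single i (1 : ℝ))

/-- The Riemannian gradient: `⟪∇f, v⟫ = df(v)` for all tangent vectors `v`. -/
def grad (f : M → ℝ) : VField n M := fun x =>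
  haveI : FiniteDimensional ℝ (TangentSpace (𝓡 n) x) :=
    inferInstanceAs (FiniteDimensional ℝ (Eucl n))
  haveI : CompleteSpace (TangentSpace (𝓡 n) x) := FiniteDimensional.complete ℝ _
  (InnerProductSpace.toDual ℝ (TangentSpace (𝓡 n) x)).symm
    (mfderiv (𝓡 n) 𝓘(ℝ, ℝ) f x : TangentSpace (𝓡 n) x →L[ℝ] ℝ)

theorem inner_grad (f : M → ℝ) (x : M) (v : TangentSpace (𝓡 n) x) :
    inner ℝ (grad f x) v = mfderiv (𝓡 n) 𝓘(ℝ, ℝ) f x v := by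
  have : FiniteDimensional ℝ (TangentSpace (𝓡 n) x) :=
    inferInstanceAs (FiniteDimensional ℝ (Eucl n))
  have : CompleteSpace (TangentSpace (𝓡 n) x) := FiniteDimensional.complete ℝ _
  exact InnerProductSpace.toDual_symm_apply

/-- The homogeneous Sobolev `Ḣ¹` product `¼ ∫ div v · div w dμ` on vector fields. -/
def h1Inner [MeasurableSpace M] (v w : VField n M) : ℝ :=
  (1 / 4) * ∫ x, divergence v x * divergence w x ∂(riemVolume n M)

/-- The first form of the equation, for the velocity `u` and its time derivative:
`∇ div u_t + div u · ∇ div u + ∇ ⟪u, ∇ div u⟫ = 0`. -/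
def GradientEquation (J : Set ℝ) (u : ℝ → VField n M) : Prop :=
  ∀ t ∈ J, ∀ x : M,
    grad (n := n) (divergence (timeDeriv J u t)) x
      + divergence (u t) x • grad (divergence (u t)) x
      + grad (fun z => inner ℝ (u t z) (grad (divergence (u t)) z)) x = 0

/-- The second form of the equation, for `h = div u`:
`h_t + ⟪u, ∇h⟫ + ½ h² = -(1 / (2 μ(M))) ∫ h² dμ`. -/
def DensityEquation [MeasurableSpace M] (J : Set ℝ) (u : ℝ → VField n M) (h : ℝ → M → ℝ) :
    Prop :=
  ∀ t ∈ J, ∀ x : M,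
    derivWithin (fun s => h s x) J t + inner ℝ (u t x) (grad (n := n) (h t) x) + (1 / 2) * h t x ^ 2
      = -(1 / (2 * (riemVolume n M univ).toReal)) * ∫ z, h t z ^ 2 ∂(riemVolume n M)

/-- A parametrization of `M` by arc length: a smooth map of `ℝ` onto `M` of unit speed. For a
circle of length `L`, this is the quotient map `ℝ → ℝ/Lℤ`. -/
structure IsArcLengthParam (n : ℕ) {M : Type*} [TopologicalSpace M] [ChartedSpace (Eucl n) M]
    [RiemannianBundle (fun x : M => TangentSpace (𝓡 n) x)] (γ : ℝ → M) : Prop where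
  smooth : ContMDiff 𝓘(ℝ, ℝ) (𝓡 n) ∞ γ
  unit_speed : ∀ s : ℝ, ‖(mfderiv 𝓘(ℝ, ℝ) (𝓡 n) γ s (1 : ℝ) : TangentSpace (𝓡 n) (γ s))‖ = 1
  surjective : Function.Surjective γ

/-- The component `⟪v, γ'⟫` of a vector field along the curve `γ`. -/
def componentAlong (γ : ℝ → M) (v : VField n M) (s : ℝ) : ℝ :=
  inner ℝ (v (γ s)) (mfderiv 𝓘(ℝ, ℝ) (𝓡 n) γ s (1 : ℝ) : TangentSpace (𝓡 n) (γ s))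

/-- The Hunter-Saxton equation `f_txx + 2 f_x f_xx + f f_xxx = 0`. -/
def HunterSaxtonEquation (J : Set ℝ) (f : ℝ → ℝ → ℝ) : Prop :=
  ∀ t ∈ J, ∀ x : ℝ,
    iteratedDeriv 2 (fun y => derivWithin (fun s => f s y) J t) x
      + 2 * deriv (f t) x * iteratedDeriv 2 (f t) x + f t x * iteratedDeriv 3 (f t) x = 0

end EulerArnold

end

/-! Write h = div u and S = div u_t + u(h) + h²/2 (`scalarForm`). Every equation in the theorem says
that dS = 0. The divergence theorem gives ∫ f div v = -∫ v(f). Applied to the pairing of h with div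
[u, w], together with [u, w]h = u(w h) - w(u h) and ∫ u(w h) = -∫ h w(h), it yields ⟨u, ad_u w⟩ +
⟨u_t, w⟩ = -¼ ∫ w(S) dμ (`h1Inner_adj_sub`). This vanishes for all smooth w exactly when dS = 0:
extend a tangent vector to a smooth field e and test with w = e(S) e.

The left side of the gradient equation is ∇S. On a connected manifold dS = 0 means that S is
constant, and integration determines the constant: ∫ div u_t = 0 and ∫ u(h) = -∫ h², so ∫ S = -½ ∫
h². In dimension one h ∘ γ = f_x (`IsArcLengthParam.hasDerivAt_componentAlong`), so S ∘ γ = f_tx + f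
f_xx + ½ f_x², whose derivative is the Hunter-Saxton expression.

Most of the work is the geometry behind this. `divergence` uses at each point the preferred chart of
that point, and `riemVolume` is a supremum over charts, so both require independence of the chart.
It comes from the factor |det Dφ| by which √G changes (`sqrtGram_transition`), and gives
`divergence_symm` and `riemVolume_restrict_source`. A partition of unity then reduces the divergence
theorem (`integral_divergence`) to compactly supported functions on ℝⁿ. Symmetry of second
derivatives, up to the endpoints of J, lets div commute with ∂_t (`divergence_timeDeriv`). -/

noncomputable section

/-! ### Vector fields and their smoothness in charts -/

namespace EulerArnold

variable {n : ℕ} {M : Type*} [TopologicalSpace M] [ChartedSpace (Eucl n) M]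

/-- The vector of components of `v` in the chart around `c`. -/
def chartVec (c : M) (v : VField n M) (y : Eucl n) : Eucl n :=
  mfderiv (𝓡 n) 𝓘(ℝ, Eucl n) (chartAt (Eucl n) c) ((chartAt (Eucl n) c).symm y)
    (v ((chartAt (Eucl n) c).symm y))

variable [IsManifold (𝓡 n) ∞ M]

-- The tangent bundle is one degree less smooth than the manifold; since ∞ + 1 = ∞, it is smooth
-- here.
scoped instance : IsManifold (𝓡 n) (∞ + 1) M := inferInstanceAs (IsManifold (𝓡 n) ∞ M)

theorem mfderiv_chart_symm (c : M) {y : Eucl n} (hy : y ∈ (chartAt (Eucl n) c).target)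
    (ξ : Eucl n) :
    mfderiv (𝓡 n) 𝓘(ℝ, Eucl n) (chartAt (Eucl n) c) ((chartAt (Eucl n) c).symm y)
      (mfderiv 𝓘(ℝ, Eucl n) (𝓡 n) (chartAt (Eucl n) c).symm y ξ) = ξ := by
  have := (mdifferentiable_chart (I := 𝓡 n) c).comp_symm_deriv hy
  exact DFunLike.congr_fun this ξ

theorem mfderiv_symm_chart (c : M) {x : M} (hx : x ∈ (chartAt (Eucl n) c).source)
    (ξ : TangentSpace (𝓡 n) x) :
    mfderiv 𝓘(ℝ, Eucl n) (𝓡 n) (chartAt (Eucl n) c).symm (chartAt (Eucl n) c x)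
      (mfderiv (𝓡 n) 𝓘(ℝ, Eucl n) (chartAt (Eucl n) c) x ξ) = ξ := by
  have := (mdifferentiable_chart (I := 𝓡 n) c).symm_comp_deriv hx
  exact DFunLike.congr_fun this ξ

theorem mfderiv_symm_chartVec (c : M) {y : Eucl n} (hy : y ∈ (chartAt (Eucl n) c).target)
    (v : VField n M) :
    mfderiv 𝓘(ℝ, Eucl n) (𝓡 n) (chartAt (Eucl n) c).symm y (chartVec c v y)
      = v ((chartAt (Eucl n) c).symm y) := by
  have h := mfderiv_symm_chart c ((chartAt (Eucl n) c).map_target hy)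
    (v ((chartAt (Eucl n) c).symm y))
  rw [(chartAt (Eucl n) c).right_inv hy] at h
  exact h

theorem trivialization_snd_eq (c : M) {x : M} (hx : x ∈ (chartAt (Eucl n) c).source)
    (ξ : TangentSpace (𝓡 n) x) :
    (trivializationAt (Eucl n) (TangentSpace (𝓡 n)) c (⟨x, ξ⟩ : TangentBundle (𝓡 n) M)).2
      = mfderiv (𝓡 n) 𝓘(ℝ, Eucl n) (chartAt (Eucl n) c) x ξ := by
  have h := TangentBundle.continuousLinearMapAt_trivializationAt (I := 𝓡 n) hx
  have h2 := DFunLike.congr_fun h ξ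
  have h3 := congrFun ((trivializationAt (Eucl n) (TangentSpace (𝓡 n)) c).continuousLinearMapAt_apply
    ℝ x) ξ
  rw [Bundle.Trivialization.coe_linearMapAt_of_mem _ (by simpa using hx)] at h3
  exact h3.symm.trans h2

section criteria
variable {N : Type*} {EN HN : Type*} [NormedAddCommGroup EN] [NormedSpace ℝ EN]
  [TopologicalSpace HN] {IN : ModelWithCorners ℝ EN HN} [TopologicalSpace N] [ChartedSpace HN N]

/-- The trivialization at `c` is the derivative of the chart. The source `N` is arbitrary because
the criterion serves fields on `M`, curves of fields on ℝ × M, and coordinate fields on ℝⁿ. -/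
theorem contMDiffOn_tangent_iff (c : M) {s : Set N} (f : N → TangentBundle (𝓡 n) M)
    (hf : ∀ p ∈ s, (f p).1 ∈ (chartAt (Eucl n) c).source) :
    ContMDiffOn IN (𝓡 n).tangent ∞ f s ↔
      ContMDiffOn IN (𝓡 n) ∞ (fun p => (f p).1) s ∧
      ContMDiffOn IN 𝓘(ℝ, Eucl n) ∞
        (fun p => (mfderiv (𝓡 n) 𝓘(ℝ, Eucl n) (chartAt (Eucl n) c) (f p).1 (f p).2 : Eucl n)) s := by
  rw [Bundle.Trivialization.contMDiffOn_iff
    (e := trivializationAt (Eucl n) (TangentSpace (𝓡 n) (M := M)) c)]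
  · refine and_congr Iff.rfl (contMDiffOn_congr fun p hp => ?_)
    exact trivialization_snd_eq c (hf p hp) (f p).2
  · intro p hp
    rw [Bundle.Trivialization.mem_source]
    simpa using hf p hp

end criteria

theorem isSmoothField_iff (v : VField n M) :
    IsSmoothField v ↔ ∀ c, ContDiffOn ℝ ∞ (chartVec c v) (chartAt (Eucl n) c).target := by
  have key : ∀ c, ContMDiffOn (𝓡 n) (𝓡 n).tangent ∞
      (fun x => (⟨x, v x⟩ : TangentBundle (𝓡 n) M)) (chartAt (Eucl n) c).source ↔
      ContDiffOn ℝ ∞ (chartVec c v) (chartAt (Eucl n) c).target := by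
    intro c
    rw [contMDiffOn_tangent_iff c _ (fun p hp => hp), ← contMDiffOn_iff_contDiffOn]
    constructor
    · rintro ⟨-, h⟩
      exact h.comp (contMDiffOn_chart_symm (I := 𝓡 n) (n := ∞) (x := c))
        (fun y hy => (chartAt (Eucl n) c).map_target hy)
    · intro h
      refine ⟨contMDiffOn_id, ?_⟩
      refine (h.comp (contMDiffOn_chart (I := 𝓡 n) (n := ∞) (x := c))
        (fun y hy => (chartAt (Eucl n) c).map_source hy)).congr fun x hx => ?_
      simp only [Function.comp, chartVec]
      rw [(chartAt (Eucl n) c).left_inv hx]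
  constructor
  · intro h c
    exact (key c).1 h.contMDiffOn
  · intro h x
    exact ((key x).2 (h x)).contMDiffAt (chart_source_mem_nhds _ x)

theorem IsSmoothCurve.contDiffOn {J : Set ℝ} {u : ℝ → VField n M} (hu : IsSmoothCurve J u)
    (c : M) :
    ContDiffOn ℝ ∞ (fun p : ℝ × Eucl n => chartVec c (u p.1) p.2)
      (J ×ˢ (chartAt (Eucl n) c).target) := by
  have h1 : ContMDiffOn (𝓘(ℝ, ℝ).prod (𝓡 n)) (𝓡 n).tangent ∞
    (fun p : ℝ × M => (⟨p.2, u p.1 p.2⟩ : TangentBundle (𝓡 n) M))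
    (J ×ˢ (chartAt (Eucl n) c).source) := hu.mono (prod_mono_right (subset_univ _))
  rw [contMDiffOn_tangent_iff c _ (fun p hp => hp.2)] at h1
  have h2 : ContMDiffOn 𝓘(ℝ, ℝ × Eucl n) (𝓘(ℝ, ℝ).prod (𝓡 n)) ∞
      (fun p : ℝ × Eucl n => (p.1, (chartAt (Eucl n) c).symm p.2))
      (J ×ˢ (chartAt (Eucl n) c).target) := by
    rw [modelWithCornersSelf_prod, ← chartedSpaceSelf_prod]
    refine contMDiffOn_fst.prodMk ?_
    exact (contMDiffOn_chart_symm (I := 𝓡 n) (n := ∞) (x := c)).comp contMDiffOn_snd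
      (fun p hp => hp.2)
  rw [← contMDiffOn_iff_contDiffOn]
  exact h1.2.comp h2 (fun p hp => ⟨hp.1, (chartAt (Eucl n) c).map_target hp.2⟩)

end EulerArnold

end

/-! ### Changes of coordinates and the volume density -/

noncomputable section

namespace EulerArnold

variable {n : ℕ} {M : Type*} [TopologicalSpace M] [ChartedSpace (Eucl n) M]

/-- The domain, in the chart around `c`, of the change of coordinates to the chart around `c'`. -/
def overlap (c c' : M) : Set (Eucl n) :=
  (chartAt (Eucl n) c).target ∩ (chartAt (Eucl n) c).symm ⁻¹' (chartAt (Eucl n) c').source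

/-- The change of coordinates from the chart around `c` to the chart around `c'`. -/
def transition (c c' : M) (y : Eucl n) : Eucl n :=
  chartAt (Eucl n) c' ((chartAt (Eucl n) c).symm y)

theorem isOpen_overlap (c c' : M) : IsOpen (overlap (n := n) c c') :=
  (chartAt (Eucl n) c).symm.isOpen_inter_preimage (chartAt (Eucl n) c').open_source

theorem transition_mem_target {c c' : M} {y : Eucl n} (hy : y ∈ overlap c c') :
    transition c c' y ∈ (chartAt (Eucl n) c').target :=
  (chartAt (Eucl n) c').map_source hy.2

theorem symm_transition {c c' : M} {y : Eucl n} (hy : y ∈ overlap c c') :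
    (chartAt (Eucl n) c').symm (transition c c' y) = (chartAt (Eucl n) c).symm y :=
  (chartAt (Eucl n) c').left_inv hy.2

theorem transition_mem_overlap {c c' : M} {y : Eucl n} (hy : y ∈ overlap c c') :
    transition c c' y ∈ overlap c' c := by
  refine ⟨transition_mem_target hy, ?_⟩
  rw [mem_preimage, symm_transition hy]
  exact (chartAt (Eucl n) c).map_target hy.1

theorem transition_transition {c c' : M} {y : Eucl n} (hy : y ∈ overlap c c') :
    transition c' c (transition c c' y) = y := by
  rw [transition, symm_transition hy]
  exact (chartAt (Eucl n) c).right_inv hy.1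

theorem injOn_transition (c c' : M) : InjOn (transition (n := n) c c') (overlap c c') := by
  intro y hy z hz h
  rw [← transition_transition hy, ← transition_transition hz, h]

section smooth
variable [IsManifold (𝓡 n) ∞ M]

theorem contDiffOn_transition (c c' : M) :
    ContDiffOn ℝ ∞ (transition (n := n) c c') (overlap c c') := by
  rw [← contMDiffOn_iff_contDiffOn]
  exact (contMDiffOn_chart (I := 𝓡 n) (n := ∞) (x := c')).comp
    ((contMDiffOn_chart_symm (I := 𝓡 n) (n := ∞) (x := c)).mono inter_subset_left)
    (fun y hy => hy.2)

theorem differentiableAt_transition {c c' : M} {y : Eucl n} (hy : y ∈ overlap c c') :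
    DifferentiableAt ℝ (transition (n := n) c c') y :=
  ((contDiffOn_transition c c').contDiffAt ((isOpen_overlap c c').mem_nhds hy)).differentiableAt
    (by simp)

theorem fderiv_transition {c c' : M} {y : Eucl n} (hy : y ∈ overlap c c') (ξ : Eucl n) :
    fderiv ℝ (transition (n := n) c c') y ξ =
      mfderiv (𝓡 n) 𝓘(ℝ, Eucl n) (chartAt (Eucl n) c') ((chartAt (Eucl n) c).symm y)
        (mfderiv 𝓘(ℝ, Eucl n) (𝓡 n) (chartAt (Eucl n) c).symm y ξ) := by
  rw [← mfderiv_eq_fderiv]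
  have h := mfderiv_comp (I := 𝓘(ℝ, Eucl n)) (I' := 𝓡 n) (I'' := 𝓘(ℝ, Eucl n)) y
    ((mdifferentiable_chart (I := 𝓡 n) c').mdifferentiableAt hy.2)
    ((mdifferentiable_chart (I := 𝓡 n) c).mdifferentiableAt_symm hy.1)
  exact DFunLike.congr_fun h ξ

theorem chartVec_transition {c c' : M} {y : Eucl n} (hy : y ∈ overlap c c') (v : VField n M) :
    chartVec c' v (transition c c' y) = fderiv ℝ (transition (n := n) c c') y (chartVec c v y) := by
  rw [fderiv_transition hy, mfderiv_symm_chartVec c hy.1, chartVec, symm_transition hy]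

theorem mfderiv_symm_transition {c c' : M} {y : Eucl n} (hy : y ∈ overlap c c') (ξ : Eucl n) :
    (mfderiv 𝓘(ℝ, Eucl n) (𝓡 n) (chartAt (Eucl n) c').symm (transition c c' y)
      (fderiv ℝ (transition (n := n) c c') y ξ) : Eucl n) =
      mfderiv 𝓘(ℝ, Eucl n) (𝓡 n) (chartAt (Eucl n) c).symm y ξ := by
  rw [fderiv_transition hy]
  exact mfderiv_symm_chart c' hy.2 _

/-- The opposite transition is a local inverse, so by the chain rule the two determinants have
product 1. -/
theorem det_fderiv_transition_ne_zero {c c' : M} {y : Eucl n} (hy : y ∈ overlap c c') :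
    (fderiv ℝ (transition (n := n) c c') y).det ≠ 0 := by
  have h : (fderiv ℝ (transition (n := n) c' c) (transition c c' y)).comp
      (fderiv ℝ (transition (n := n) c c') y) = ContinuousLinearMap.id ℝ _ := by
    rw [← fderiv_comp _ (differentiableAt_transition (transition_mem_overlap hy))
      (differentiableAt_transition hy)]
    rw [← fderiv_id (𝕜 := ℝ) (x := y)]
    apply Filter.EventuallyEq.fderiv_eq
    filter_upwards [(isOpen_overlap c c').mem_nhds hy] with z hz
    exact transition_transition hz
  intro h0
  have h1 := congrArg ContinuousLinearMap.det h
  rw [ContinuousLinearMap.det, ContinuousLinearMap.toLinearMap_comp, LinearMap.det_comp] at h1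
  rw [ContinuousLinearMap.det] at h0
  rw [h0, mul_zero, ContinuousLinearMap.det] at h1
  simp at h1

theorem contMDiffOn_coordField (c : M) (i : Fin n) :
    ContMDiffOn 𝓘(ℝ, Eucl n) (𝓡 n).tangent ∞
      (fun y => (⟨(chartAt (Eucl n) c).symm y, coordField c i y⟩ : TangentBundle (𝓡 n) M))
      (chartAt (Eucl n) c).target := by
  rw [contMDiffOn_tangent_iff c _ (fun y hy => (chartAt (Eucl n) c).map_target hy)]
  refine ⟨contMDiffOn_chart_symm, ?_⟩
  refine (contMDiffOn_const (c := (EuclideanSpace.single i (1 : ℝ) : Eucl n))).congr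
    fun y hy => mfderiv_chart_symm c hy _

end smooth

variable [RiemannianBundle (fun x : M => TangentSpace (𝓡 n) x)]

/-- The Riemannian metric in the chart around `c`, at the point with coordinates `y`. -/
def chartMetric (c : M) (y : Eucl n) : LinearMap.BilinForm ℝ (Eucl n) :=
  (innerₗ (TangentSpace (𝓡 n) ((chartAt (Eucl n) c).symm y))).compl₁₂
    (mfderiv 𝓘(ℝ, Eucl n) (𝓡 n) (chartAt (Eucl n) c).symm y).toLinearMap
    (mfderiv 𝓘(ℝ, Eucl n) (𝓡 n) (chartAt (Eucl n) c).symm y).toLinearMap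

theorem chartMetric_apply (c : M) (y ξ η : Eucl n) : chartMetric c y ξ η =
    inner ℝ (mfderiv 𝓘(ℝ, Eucl n) (𝓡 n) (chartAt (Eucl n) c).symm y ξ)
      (mfderiv 𝓘(ℝ, Eucl n) (𝓡 n) (chartAt (Eucl n) c).symm y η) := rfl

theorem sqrtGram_eq (c : M) (y : Eucl n) : sqrtGram c y =
    √(LinearMap.BilinForm.toMatrix (EuclideanSpace.basisFun (Fin n) ℝ).toBasis
      (chartMetric c y)).det := by
  rw [sqrtGram]
  congr 2

/-- Fibres over equal points are the same vector space but carry inner products indexed by the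
point; this transports one to the other. -/
theorem inner_congr_point {p q : M} (h : p = q) (a b : Eucl n) :
    (innerₗ (TangentSpace (𝓡 n) p)) a b = (innerₗ (TangentSpace (𝓡 n) q)) a b := by
  subst h; rfl

variable [IsManifold (𝓡 n) ∞ M]

theorem chartMetric_transition {c c' : M} {y : Eucl n} (hy : y ∈ overlap c c') :
    chartMetric c y = (chartMetric c' (transition c c' y)).compl₁₂
      (fderiv ℝ (transition (n := n) c c') y).toLinearMap
      (fderiv ℝ (transition (n := n) c c') y).toLinearMap := by
  ext ξ η
  rw [LinearMap.compl₁₂_apply, chartMetric_apply, chartMetric_apply]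
  refine (inner_congr_point (M := M) (symm_transition hy) _ _).symm.trans ?_
  rw [← mfderiv_symm_transition hy ξ, ← mfderiv_symm_transition hy η]
  rfl

/-- The Gram matrix changes by a congruence AᵀGA, so its determinant acquires (det A)² and the root
|det A|. -/
theorem sqrtGram_transition {c c' : M} {y : Eucl n} (hy : y ∈ overlap c c') :
    sqrtGram c y = |(fderiv ℝ (transition (n := n) c c') y).det| *
      sqrtGram c' (transition c c' y) := by
  rw [sqrtGram_eq, sqrtGram_eq, chartMetric_transition hy]
  have h := LinearMap.BilinForm.toMatrix_comp (EuclideanSpace.basisFun (Fin n) ℝ).toBasis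
    (EuclideanSpace.basisFun (Fin n) ℝ).toBasis (chartMetric c' (transition c c' y))
    (fderiv ℝ (transition (n := n) c c') y).toLinearMap
    (fderiv ℝ (transition (n := n) c c') y).toLinearMap
  rw [LinearMap.BilinForm.comp] at h
  rw [h, Matrix.det_mul, Matrix.det_mul, Matrix.det_transpose, LinearMap.det_toMatrix,
    ContinuousLinearMap.det, mul_right_comm, ← pow_two, Real.sqrt_mul (sq_nonneg _),
    Real.sqrt_sq_eq_abs]

/-- The coordinate fields are independent, being the image of a basis under an injective derivative,
and the Gram matrix of an independent family is positive definite. -/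
theorem det_gram_pos (c : M) {y : Eucl n} (hy : y ∈ (chartAt (Eucl n) c).target) :
    0 < (Matrix.of fun i j : Fin n => inner ℝ (coordField c i y) (coordField c j y)).det := by
  have hli : LinearIndependent ℝ (fun i => coordField c i y) := by
    have h := (EuclideanSpace.basisFun (Fin n) ℝ).toBasis.linearIndependent
    have h2 := h.map' (mfderiv 𝓘(ℝ, Eucl n) (𝓡 n) (chartAt (Eucl n) c).symm y).toLinearMap
      (LinearMap.ker_eq_bot_of_injective fun a b hab => by
        have := congrArg (mfderiv (𝓡 n) 𝓘(ℝ, Eucl n) (chartAt (Eucl n) c)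
          ((chartAt (Eucl n) c).symm y)) hab
        exact ((mfderiv_chart_symm c hy a).symm.trans this).trans (mfderiv_chart_symm c hy b))
    convert! h2 using 1
    ext i
    simp [coordField]
    rfl
  exact (Matrix.posDef_gram_of_linearIndependent hli).det_pos

theorem sqrtGram_pos (c : M) {y : Eucl n} (hy : y ∈ (chartAt (Eucl n) c).target) :
    0 < sqrtGram c y := Real.sqrt_pos.2 (det_gram_pos c hy)

variable [IsContMDiffRiemannianBundle (𝓡 n) ∞ (Eucl n) (fun x : M => TangentSpace (𝓡 n) x)]

theorem contDiffOn_sqrtGram (c : M) :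
    ContDiffOn ℝ ∞ (sqrtGram (n := n) c) (chartAt (Eucl n) c).target := by
  refine ContDiffOn.sqrt ?_ (fun y hy => (det_gram_pos c hy).ne')
  simp only [Matrix.det_apply]
  refine ContDiffOn.sum fun σ _ => ContDiffOn.const_smul _ (contDiffOn_prod fun i _ => ?_)
  rw [← contMDiffOn_iff_contDiffOn]
  exact ContMDiffOn.inner_bundle (F := Eucl n) (E := fun x : M => TangentSpace (𝓡 n) x) (contMDiffOn_coordField c _) (contMDiffOn_coordField c _)

end EulerArnold

end

/-! ### Divergence with respect to a density on ℝⁿ -/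

noncomputable section

namespace EulerArnold

section calculus
variable {n : ℕ}

theorem det_eq_det_entries (A : Eucl n →L[ℝ] Eucl n) :
    A.det = (Matrix.of fun i j => A (EuclideanSpace.single j (1 : ℝ)) i).det := by
  rw [ContinuousLinearMap.det,
    ← LinearMap.det_toMatrix (EuclideanSpace.basisFun (Fin n) ℝ).toBasis]
  congr 1

theorem trace_eq_sum (A : Eucl n →L[ℝ] Eucl n) :
    LinearMap.trace ℝ _ A.toLinearMap = ∑ i, A (EuclideanSpace.single i (1 : ℝ)) i := by
  rw [LinearMap.trace_eq_matrix_trace ℝ (EuclideanSpace.basisFun (Fin n) ℝ).toBasis, Matrix.trace]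
  simp [LinearMap.toMatrix_apply]

theorem contDiff_det : ContDiff ℝ ∞ fun A : Eucl n →L[ℝ] Eucl n => A.det := by
  simp only [det_eq_det_entries, Matrix.det_apply, Matrix.of_apply]
  refine ContDiff.sum fun σ _ => ContDiff.const_smul _ (contDiff_prod fun i _ => ?_)
  fun_prop

/-- This is the first-order term of det(1 + sB) = 1 + s tr B + O(s²). -/
theorem fderiv_det_one (B : Eucl n →L[ℝ] Eucl n) :
    fderiv ℝ (fun A : Eucl n →L[ℝ] Eucl n => A.det) (ContinuousLinearMap.id ℝ _) B =
      LinearMap.trace ℝ _ B.toLinearMap := by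
  have hd : DifferentiableAt ℝ (fun A : Eucl n →L[ℝ] Eucl n => A.det)
      (ContinuousLinearMap.id ℝ _) := contDiff_det.differentiable (by simp) _
  rw [← hd.lineDeriv_eq_fderiv, lineDeriv]
  set m := LinearMap.toMatrix (EuclideanSpace.basisFun (Fin n) ℝ).toBasis
    (EuclideanSpace.basisFun (Fin n) ℝ).toBasis B.toLinearMap with hm
  -- The determinant is a polynomial in s; `divX.divX` is what remains after the terms of degree 0
  -- and 1 are removed, so the error is s² times a polynomial.
  have h3 : ∀ s : ℝ, (ContinuousLinearMap.id ℝ (Eucl n) + s • B).det = 1 + m.trace * s +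
      (Matrix.det (1 + (Polynomial.X : Polynomial ℝ) • m.map Polynomial.C)).divX.divX.eval s
        * s ^ 2 := by
    intro s
    rw [← Matrix.det_one_add_smul, ContinuousLinearMap.det,
      ← LinearMap.det_toMatrix (EuclideanSpace.basisFun (Fin n) ℝ).toBasis]
    congr 1
    rw [ContinuousLinearMap.toLinearMap_add, map_add, ContinuousLinearMap.coe_id, LinearMap.toMatrix_id,
      ContinuousLinearMap.toLinearMap_smul, map_smul]
  simp only [h3]
  have h4 := (((hasDerivAt_id (0 : ℝ)).const_mul m.trace).const_add 1).add
    (((Matrix.det (1 + (Polynomial.X : Polynomial ℝ) • m.map Polynomial.C)).divX.divX.hasDerivAt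
      0).mul ((hasDerivAt_id (0 : ℝ)).pow 2))
  refine Eq.trans h4.deriv ?_
  simp [LinearMap.trace_eq_matrix_trace ℝ (EuclideanSpace.basisFun (Fin n) ℝ).toBasis, hm]

/-- The derivative of the determinant of a field of invertible operators. -/
theorem fderiv_det_comp {f : Eucl n → Eucl n →L[ℝ] Eucl n} {y : Eucl n}
    (hf : DifferentiableAt ℝ f y) (B : Eucl n →L[ℝ] Eucl n)
    (hB : B.comp (f y) = ContinuousLinearMap.id ℝ _)
    (hB' : (f y).comp B = ContinuousLinearMap.id ℝ _) (ξ : Eucl n) :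
    HasFDerivAt (fun z => (f z).det) (fderiv ℝ (fun z => (f z).det) y) y ∧
    fderiv ℝ (fun z => (f z).det) y ξ =
      (f y).det * LinearMap.trace ℝ _ (B.comp (fderiv ℝ f y ξ)).toLinearMap := by
  -- Factoring out f(y) moves the base point of the derivative of det to the identity.
  have h1 : ∀ z, (f z).det = (f y).det * (B.comp (f z)).det := by
    intro z
    have : f z = (f y).comp (B.comp (f z)) := by
      rw [← ContinuousLinearMap.comp_assoc, hB', ContinuousLinearMap.id_comp]
    conv_lhs => rw [this]
    simp only [ContinuousLinearMap.det, ContinuousLinearMap.toLinearMap_comp, LinearMap.det_comp]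
  have hd : HasFDerivAt (fun A : Eucl n →L[ℝ] Eucl n => A.det)
      (fderiv ℝ (fun A : Eucl n →L[ℝ] Eucl n => A.det) (ContinuousLinearMap.id ℝ _))
      (B.comp (f y)) := by
    rw [hB]
    exact (contDiff_det.differentiable (by simp) _).hasFDerivAt
  have h2 : HasFDerivAt (fun z => B.comp (f z))
      ((ContinuousLinearMap.compL ℝ (Eucl n) (Eucl n) (Eucl n) B).comp (fderiv ℝ f y)) y :=
    (ContinuousLinearMap.compL ℝ (Eucl n) (Eucl n) (Eucl n) B).hasFDerivAt.comp y hf.hasFDerivAt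
  have h3 := (hd.comp y h2).const_mul (f y).det
  have h4 : HasFDerivAt (fun z => (f z).det) _ y := h3.congr_of_eventuallyEq
    (Filter.Eventually.of_forall fun z => h1 z)
  refine ⟨h4.differentiableAt.hasFDerivAt, ?_⟩
  rw [h4.fderiv]
  simp [fderiv_det_one]

/-- The divergence of the vector field `V` with respect to the density `ρ`. -/
def weightedDiv (ρ : Eucl n → ℝ) (V : Eucl n → Eucl n) (y : Eucl n) : ℝ :=
  (ρ y)⁻¹ * ∑ i : Fin n, fderiv ℝ (fun z => ρ z * V z i) y (EuclideanSpace.single i (1 : ℝ))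

/-- The product rule separates the logarithmic derivative of the density from a trace, both free of
coordinates. -/
theorem weightedDiv_eq {ρ : Eucl n → ℝ} {V : Eucl n → Eucl n} {y : Eucl n}
    (hρ : DifferentiableAt ℝ ρ y) (hV : DifferentiableAt ℝ V y) (h0 : ρ y ≠ 0) :
    weightedDiv ρ V y =
      (ρ y)⁻¹ * fderiv ℝ ρ y (V y) + LinearMap.trace ℝ _ (fderiv ℝ V y).toLinearMap := by
  have h1 : ∀ i : Fin n, fderiv ℝ (fun z => ρ z * V z i) y (EuclideanSpace.single i (1 : ℝ)) =
      ρ y * (fderiv ℝ V y (EuclideanSpace.single i (1 : ℝ))) i +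
        V y i * fderiv ℝ ρ y (EuclideanSpace.single i (1 : ℝ)) := by
    intro i
    have hVi : HasFDerivAt (fun z => V z i)
        ((EuclideanSpace.proj i : Eucl n →L[ℝ] ℝ).comp (fderiv ℝ V y)) y :=
      (EuclideanSpace.proj i : Eucl n →L[ℝ] ℝ).hasFDerivAt.comp y hV.hasFDerivAt
    rw [(hρ.hasFDerivAt.fun_mul hVi).fderiv]
    simp
  have h2 : ∑ i, V y i * fderiv ℝ ρ y (EuclideanSpace.single i (1 : ℝ)) = fderiv ℝ ρ y (V y) := by
    conv_rhs => rw [← (EuclideanSpace.basisFun (Fin n) ℝ).sum_repr (V y)]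
    simp
  rw [weightedDiv, Finset.sum_congr rfl fun i _ => h1 i, Finset.sum_add_distrib, h2, trace_eq_sum,
    ← Finset.mul_sum]
  field_simp
  ring

/-- With A = Dφ(y) and B = A⁻¹, differentiating W ∘ φ = Dφ V adds tr(B D²φ(V, ·)) to the trace. By
Jacobi's formula this is the logarithmic derivative of |det Dφ| along V, which is what the change of
density contributes on the other side. -/
theorem weightedDiv_transform {ρ σ : Eucl n → ℝ} {φ V W : Eucl n → Eucl n} {y : Eucl n}
    (hφ : ContDiffAt ℝ 2 φ y) (hdet : (fderiv ℝ φ y).det ≠ 0)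
    (hσ : DifferentiableAt ℝ σ (φ y)) (hσ0 : σ (φ y) ≠ 0)
    (hV : DifferentiableAt ℝ V y) (hW : DifferentiableAt ℝ W (φ y))
    (hVW : ∀ᶠ z in nhds y, W (φ z) = fderiv ℝ φ z (V z))
    (hρσ : ∀ᶠ z in nhds y, ρ z = |(fderiv ℝ φ z).det| * σ (φ z)) :
    weightedDiv ρ V y = weightedDiv σ W (φ y) := by
  set A := fderiv ℝ φ y with hA
  obtain ⟨B, hBA, hAB⟩ : ∃ B : Eucl n →L[ℝ] Eucl n,
      B.comp A = ContinuousLinearMap.id ℝ _ ∧ A.comp B = ContinuousLinearMap.id ℝ _ := by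
    refine ⟨(A.toContinuousLinearEquivOfDetNeZero hdet).symm, ?_, ?_⟩
    · ext1 x
      exact (A.toContinuousLinearEquivOfDetNeZero hdet).symm_apply_apply x
    · ext1 x
      exact (A.toContinuousLinearEquivOfDetNeZero hdet).apply_symm_apply x
  have hφ1 : DifferentiableAt ℝ φ y := hφ.differentiableAt (by simp)
  have hdφ : DifferentiableAt ℝ (fderiv ℝ φ) y :=
    (hφ.fderiv_right (m := 1) (by norm_num)).differentiableAt (by simp)
  have hsymm : ∀ ξ η, fderiv ℝ (fderiv ℝ φ) y ξ η = fderiv ℝ (fderiv ℝ φ) y η ξ :=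
    (hφ.isSymmSndFDerivAt (by simp)).eq
  have hdet' := fun ξ => fderiv_det_comp hdφ B hBA hAB ξ
  have habs := (hdet' 0).1.abs hdet
  have hρ : HasFDerivAt ρ _ y :=
    (habs.mul (hσ.hasFDerivAt.comp y hφ1.hasFDerivAt)).congr_of_eventuallyEq hρσ
  have hρy : ρ y = |A.det| * σ (φ y) := hρσ.self_of_nhds
  have hρ0 : ρ y ≠ 0 := by rw [hρy]; exact mul_ne_zero (abs_ne_zero.2 hdet) hσ0
  have hWy : W (φ y) = A (V y) := hVW.self_of_nhds
  -- Symmetry of D²φ allows V to be moved into the first slot.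
  have hDW : (fderiv ℝ W (φ y)).comp A =
      (fderiv ℝ (fderiv ℝ φ) y (V y)) + A.comp (fderiv ℝ V y) := by
    rw [hA, ← fderiv_comp y hW hφ1, Filter.EventuallyEq.fderiv_eq (f₁ := W ∘ φ) hVW, fderiv_clm_apply hdφ hV]
    ext1 ξ
    simp [hsymm ξ (V y), add_comm]
  -- DW is conjugate to B (DW A), so cyclicity of the trace applies.
  have hDW' : LinearMap.trace ℝ _ (fderiv ℝ W (φ y)).toLinearMap =
      LinearMap.trace ℝ _ (B.comp (fderiv ℝ (fderiv ℝ φ) y (V y))).toLinearMap +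
        LinearMap.trace ℝ _ (fderiv ℝ V y).toLinearMap := by
    have h1 : fderiv ℝ W (φ y) = ((fderiv ℝ W (φ y)).comp A).comp B := by
      rw [ContinuousLinearMap.comp_assoc, hAB, ContinuousLinearMap.comp_id]
    rw [h1, ContinuousLinearMap.toLinearMap_comp, LinearMap.trace_comp_comm',
      ← ContinuousLinearMap.toLinearMap_comp, hDW, ContinuousLinearMap.comp_add,
      ← ContinuousLinearMap.comp_assoc, hBA, ContinuousLinearMap.id_comp, ← map_add]
    rfl
  rw [weightedDiv_eq hρ.differentiableAt hV hρ0, weightedDiv_eq hσ hW hσ0, hDW', hρ.fderiv, hWy,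
    hρy]
  simp only [add_apply, smul_apply, smul_eq_mul,
    ContinuousLinearMap.comp_apply, (hdet' (V y)).2]
  have habs0 : |A.det| ≠ 0 := abs_ne_zero.2 hdet
  have hsg : ∀ r : ℝ, (SignType.sign A.det : ℝ) * (A.det * r) = |A.det| * r := by
    intro r
    rw [← mul_assoc, sign_mul_self]
  rw [← hA, hsg, Function.comp_apply]
  field_simp
  ring

end calculus

end EulerArnold

end

/-! ### Calculus of directional derivatives and divergence on the manifold -/

noncomputable section

namespace EulerArnold

variable {n : ℕ} {M : Type*} [TopologicalSpace M] [ChartedSpace (Eucl n) M]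

/-- The derivative `v f` of a function along a vector field. -/
def dirDeriv (f : M → ℝ) (v : VField n M) (x : M) : ℝ :=
  mfderiv (𝓡 n) 𝓘(ℝ, ℝ) f x (v x)

theorem dirDeriv_smul (f g : M → ℝ) (v : VField n M) (x : M) :
    dirDeriv f (fun z => g z • v z) x = g x * dirDeriv f v x :=
  (mfderiv (𝓡 n) 𝓘(ℝ, ℝ) f x).map_smul (g x) (v x)

section rules
variable {f g : M → ℝ}

theorem dirDeriv_add_fun {x : M} (hf : MDifferentiableAt (𝓡 n) 𝓘(ℝ, ℝ) f x)
    (hg : MDifferentiableAt (𝓡 n) 𝓘(ℝ, ℝ) g x) (v : VField n M) :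
    dirDeriv (fun z => f z + g z) v x = dirDeriv f v x + dirDeriv g v x :=
  DFunLike.congr_fun (hf.hasMFDerivAt.add hg.hasMFDerivAt).mfderiv (v x)

theorem dirDeriv_mul_fun {x : M} (hf : MDifferentiableAt (𝓡 n) 𝓘(ℝ, ℝ) f x)
    (hg : MDifferentiableAt (𝓡 n) 𝓘(ℝ, ℝ) g x) (v : VField n M) :
    dirDeriv (fun z => f z * g z) v x = f x * dirDeriv g v x + g x * dirDeriv f v x :=
  DFunLike.congr_fun (hf.hasMFDerivAt.mul hg.hasMFDerivAt).mfderiv (v x)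

theorem dirDeriv_sum_fun {ι : Type*} (s : Finset ι) {F : ι → M → ℝ} {x : M}
    (hF : ∀ i ∈ s, MDifferentiableAt (𝓡 n) 𝓘(ℝ, ℝ) (F i) x) (v : VField n M) :
    dirDeriv (fun z => ∑ i ∈ s, F i z) v x = ∑ i ∈ s, dirDeriv (F i) v x := by
  classical
  -- Differentiability of the partial sum is carried through the induction because the sum rule
  -- needs it.
  have key : ∀ s : Finset ι, (∀ i ∈ s, MDifferentiableAt (𝓡 n) 𝓘(ℝ, ℝ) (F i) x) →
      MDifferentiableAt (𝓡 n) 𝓘(ℝ, ℝ) (fun z => ∑ i ∈ s, F i z) x ∧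
      dirDeriv (fun z => ∑ i ∈ s, F i z) v x = ∑ i ∈ s, dirDeriv (F i) v x := by
    intro s
    induction s using Finset.induction_on with
    | empty =>
      intro _
      refine ⟨by simpa using mdifferentiableAt_const, ?_⟩
      rw [Finset.sum_empty]
      exact DFunLike.congr_fun (mfderiv_const (I := 𝓡 n) (I' := 𝓘(ℝ, ℝ)) (c := (0 : ℝ))) (v x)
    | insert a s ha ih =>
      intro h
      obtain ⟨h1, h2⟩ := ih fun i hi => h i (Finset.mem_insert_of_mem hi)
      have h3 := h a (Finset.mem_insert_self a s)
      simp only [Finset.sum_insert ha]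
      exact ⟨h3.add h1, by rw [dirDeriv_add_fun h3 h1, h2]⟩
  exact (key s hF).2

end rules

variable [IsManifold (𝓡 n) ∞ M]

theorem contMDiff_iff_forall_chart {f : M → ℝ} : ContMDiff (𝓡 n) 𝓘(ℝ, ℝ) ∞ f ↔
    ∀ c : M, ContDiffOn ℝ ∞ (fun y => f ((chartAt (Eucl n) c).symm y))
      (chartAt (Eucl n) c).target := by
  constructor
  · intro h c
    rw [← contMDiffOn_iff_contDiffOn]
    exact h.comp_contMDiffOn (contMDiffOn_chart_symm (I := 𝓡 n) (n := ∞) (x := c))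
  · intro h x
    have h1 := (contMDiffOn_iff_contDiffOn.2 (h x)).comp
      (contMDiffOn_chart (I := 𝓡 n) (n := ∞) (x := x))
      (fun y hy => (chartAt (Eucl n) x).map_source hy)
    refine (h1.congr fun y hy => ?_).contMDiffAt (chart_source_mem_nhds _ x)
    simp only [Function.comp]
    rw [(chartAt (Eucl n) x).left_inv hy]

theorem dirDeriv_symm {f : M → ℝ} (hf : ContMDiff (𝓡 n) 𝓘(ℝ, ℝ) ∞ f) (v : VField n M) (c : M)
    {y : Eucl n} (hy : y ∈ (chartAt (Eucl n) c).target) :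
    dirDeriv f v ((chartAt (Eucl n) c).symm y) =
      fderiv ℝ (fun z => f ((chartAt (Eucl n) c).symm z)) y (chartVec c v y) := by
  rw [← mfderiv_eq_fderiv]
  have h := mfderiv_comp (I := 𝓘(ℝ, Eucl n)) (I' := 𝓡 n) (I'' := 𝓘(ℝ, ℝ)) y
    (hf.mdifferentiable (by simp) _)
    ((mdifferentiable_chart (I := 𝓡 n) c).mdifferentiableAt_symm hy)
  refine Eq.trans ?_ (DFunLike.congr_fun h _).symm
  rw [dirDeriv, ← mfderiv_symm_chartVec c hy v]
  rfl

theorem contMDiff_dirDeriv {f : M → ℝ} (hf : ContMDiff (𝓡 n) 𝓘(ℝ, ℝ) ∞ f) {v : VField n M}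
    (hv : IsSmoothField v) : ContMDiff (𝓡 n) 𝓘(ℝ, ℝ) ∞ (dirDeriv f v) := by
  rw [contMDiff_iff_forall_chart]
  intro c
  have h1 := (contMDiff_iff_forall_chart.1 hf c).fderiv_of_isOpen (m := ∞)
    (chartAt (Eucl n) c).open_target (by simp)
  exact (h1.clm_apply ((isSmoothField_iff v).1 hv c)).congr fun y hy => dirDeriv_symm hf v c hy

theorem IsSmoothField.smul {f : M → ℝ} (hf : ContMDiff (𝓡 n) 𝓘(ℝ, ℝ) ∞ f) {v : VField n M}
    (hv : IsSmoothField v) : IsSmoothField fun x => f x • v x := by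
  rw [isSmoothField_iff] at hv ⊢
  intro c
  refine ((contMDiff_iff_forall_chart.1 hf c).smul (hv c)).congr fun y hy => ?_
  exact (mfderiv (𝓡 n) 𝓘(ℝ, Eucl n) (chartAt (Eucl n) c)
    ((chartAt (Eucl n) c).symm y)).map_smul _ _

theorem IsSmoothField.differentiableAt {v : VField n M} (hv : IsSmoothField v) (c : M)
    {y : Eucl n} (hy : y ∈ (chartAt (Eucl n) c).target) :
    DifferentiableAt ℝ (chartVec c v) y :=
  (((isSmoothField_iff v).1 hv c).contDiffAt
    ((chartAt (Eucl n) c).open_target.mem_nhds hy)).differentiableAt (by simp)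

variable [RiemannianBundle (fun x : M => TangentSpace (𝓡 n) x)]

omit [IsManifold (𝓡 n) ∞ M] in
theorem divergence_def (v : VField n M) (x : M) :
    divergence v x = weightedDiv (sqrtGram x) (chartVec x v) (chartAt (Eucl n) x x) := rfl

omit [IsManifold (𝓡 n) ∞ M] in
theorem divergence_neg (v : VField n M) (x : M) :
    divergence (fun z => -v z) x = -divergence v x := by
  have h : chartVec x (fun z => -v z) = fun y => -chartVec x v y := by
    ext1 y
    exact (mfderiv (𝓡 n) 𝓘(ℝ, Eucl n) (chartAt (Eucl n) x)
      ((chartAt (Eucl n) x).symm y)).map_neg _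
  simp only [divergence_def, h, weightedDiv, PiLp.neg_apply, mul_neg, fderiv_fun_neg,
    neg_apply, Finset.sum_neg_distrib]

variable [IsContMDiffRiemannianBundle (𝓡 n) ∞ (Eucl n) (fun x : M => TangentSpace (𝓡 n) x)]

theorem differentiableAt_sqrtGram (c : M) {y : Eucl n} (hy : y ∈ (chartAt (Eucl n) c).target) :
    DifferentiableAt ℝ (sqrtGram (n := n) c) y :=
  ((contDiffOn_sqrtGram c).contDiffAt
    ((chartAt (Eucl n) c).open_target.mem_nhds hy)).differentiableAt (by simp)

/-- The divergence can be computed in any chart. -/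
theorem divergence_symm {v : VField n M} (hv : IsSmoothField v) (c : M)
    {y : Eucl n} (hy : y ∈ (chartAt (Eucl n) c).target) :
    divergence v ((chartAt (Eucl n) c).symm y) =
      weightedDiv (sqrtGram c) (chartVec c v) y := by
  set x := (chartAt (Eucl n) c).symm y with hx
  have hyO : y ∈ overlap c x := ⟨hy, mem_chart_source _ x⟩
  have hO := (isOpen_overlap c x).mem_nhds hyO
  have hφ : transition c x y = chartAt (Eucl n) x x := rfl
  have ht := transition_mem_target hyO
  -- The definition evaluates in the preferred chart of x, where the coordinates of x are the image
  -- of y under the transition.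
  rw [divergence_def, ← hφ]
  refine (weightedDiv_transform
    (((contDiffOn_transition c x).contDiffAt hO).of_le (mod_cast le_top : ((2 : ℕ∞) : WithTop ℕ∞) ≤ ∞))
    (det_fderiv_transition_ne_zero hyO) (differentiableAt_sqrtGram x ht) (sqrtGram_pos x ht).ne'
    (hv.differentiableAt c hy) (hv.differentiableAt x ht) ?_ ?_).symm
  · filter_upwards [hO] with z hz using chartVec_transition hz v
  · filter_upwards [hO] with z hz using sqrtGram_transition hz

/-- The chart in the definition varies with the point, so smoothness becomes visible only after
`divergence_symm` has fixed one chart. -/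
theorem contMDiff_divergence {v : VField n M} (hv : IsSmoothField v) :
    ContMDiff (𝓡 n) 𝓘(ℝ, ℝ) ∞ (divergence v) := by
  rw [contMDiff_iff_forall_chart]
  intro c
  refine ContDiffOn.congr ?_ fun y hy => divergence_symm hv c hy
  refine ((contDiffOn_sqrtGram c).inv fun y hy => (sqrtGram_pos c hy).ne').mul
    (ContDiffOn.sum fun i _ => ?_)
  have h1 : ContDiffOn ℝ ∞ (fun z => sqrtGram c z * chartVec c v z i)
      (chartAt (Eucl n) c).target := by
    refine (contDiffOn_sqrtGram c).mul ?_
    exact (EuclideanSpace.proj i : Eucl n →L[ℝ] ℝ).contDiff.comp_contDiffOn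
      ((isSmoothField_iff v).1 hv c)
  exact (h1.fderiv_of_isOpen (m := ∞) (chartAt (Eucl n) c).open_target (by simp)).clm_apply
    contDiffOn_const

theorem divergence_smul {f : M → ℝ} (hf : ContMDiff (𝓡 n) 𝓘(ℝ, ℝ) ∞ f) {v : VField n M}
    (hv : IsSmoothField v) (x : M) :
    divergence (fun z => f z • v z) x = f x * divergence v x + dirDeriv f v x := by
  set y := chartAt (Eucl n) x x with hy
  have hyt : y ∈ (chartAt (Eucl n) x).target := mem_chart_target _ x
  have hyx : (chartAt (Eucl n) x).symm y = x := (chartAt (Eucl n) x).left_inv (mem_chart_source _ x)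
  have hfd : DifferentiableAt ℝ (fun z => f ((chartAt (Eucl n) x).symm z)) y :=
    ((contMDiff_iff_forall_chart.1 hf x).contDiffAt
      ((chartAt (Eucl n) x).open_target.mem_nhds hyt)).differentiableAt (by simp)
  have h : chartVec x (fun z => f z • v z) =
      fun y => f ((chartAt (Eucl n) x).symm y) • chartVec x v y := by
    ext1 y
    exact (mfderiv (𝓡 n) 𝓘(ℝ, Eucl n) (chartAt (Eucl n) x)
      ((chartAt (Eucl n) x).symm y)).map_smul _ _
  have hd := dirDeriv_symm hf v x hyt
  have hVd := hv.differentiableAt x hyt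
  have hρ := differentiableAt_sqrtGram x hyt
  have hρ0 := (sqrtGram_pos x hyt).ne'
  have hVd' := hfd.fun_smul hVd
  rw [hyx] at hd
  rw [divergence_def, divergence_def, ← hy, h, weightedDiv_eq hρ hVd' hρ0,
    weightedDiv_eq hρ hVd hρ0, trace_eq_sum, trace_eq_sum, fderiv_fun_smul hfd hVd, hd]
  have h2 : ∑ i, chartVec x v y i * fderiv ℝ (fun z => f ((chartAt (Eucl n) x).symm z)) y
      (EuclideanSpace.single i (1 : ℝ)) =
      fderiv ℝ (fun z => f ((chartAt (Eucl n) x).symm z)) y (chartVec x v y) := by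
    conv_rhs => rw [← (EuclideanSpace.basisFun (Fin n) ℝ).sum_repr (chartVec x v y)]
    simp
  simp only [add_apply, smul_apply, ContinuousLinearMap.smulRight_apply, PiLp.add_apply,
    PiLp.smul_apply, smul_eq_mul, Finset.sum_add_distrib, map_smul, hyx, ← h2, ← Finset.mul_sum]
  rw [Finset.sum_congr rfl fun i _ => mul_comm (chartVec x v y i) _]
  ring

end EulerArnold

end

/-! ### Time derivatives up to the endpoints of J -/

noncomputable section

namespace EulerArnold

section calculus
variable {E : Type*} [NormedAddCommGroup E] [NormedSpace ℝ E]
  {F : Type*} [NormedAddCommGroup F] [NormedSpace ℝ F] {J : Set ℝ} {O : Set E}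

theorem interior_nonempty_of_ordConnected (hJ : J.OrdConnected) (hJ' : J.Nontrivial) :
    (interior J).Nonempty := by
  obtain ⟨a, ha, b, hb, hab⟩ := hJ'.exists_lt
  have h : Ioo a b ⊆ interior J :=
    interior_maximal (Ioo_subset_Icc_self.trans (hJ.out ha hb)) isOpen_Ioo
  exact (nonempty_Ioo.2 hab).mono h

theorem uniqueDiffOn_of_ordConnected (hJ : J.OrdConnected) (hJ' : J.Nontrivial) :
    UniqueDiffOn ℝ J :=
  uniqueDiffOn_convex hJ.convex (interior_nonempty_of_ordConnected hJ hJ')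

omit [NormedSpace ℝ E] in
-- At an endpoint of J the second derivative within J × O is symmetric because the point is a limit
-- of interior points.
theorem subset_closure_interior_prod (hJ : J.OrdConnected) (hJ' : J.Nontrivial) (hO : IsOpen O) :
    J ×ˢ O ⊆ closure (interior (J ×ˢ O)) := by
  rw [interior_prod_eq, closure_prod_eq, hO.interior_eq,
    (hJ.convex : Convex ℝ J).closure_interior_eq_closure_of_nonempty_interior
      (interior_nonempty_of_ordConnected hJ hJ')]
  exact prod_mono subset_closure subset_closure

theorem derivWithin_fst {G : ℝ × E → F} {t : ℝ} {y : E}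
    (hJ : UniqueDiffOn ℝ J) (ht : t ∈ J) (hy : y ∈ O)
    (hG : DifferentiableWithinAt ℝ G (J ×ˢ O) (t, y)) :
    derivWithin (fun s => G (s, y)) J t = fderivWithin ℝ G (J ×ˢ O) (t, y) (1, 0) := by
  have h1 : HasDerivWithinAt (fun s : ℝ => (s, y)) ((1 : ℝ), (0 : E)) J t :=
    (hasDerivWithinAt_id t J).prodMk (hasDerivWithinAt_const t J y)
  have h2 : MapsTo (fun s : ℝ => (s, y)) J (J ×ˢ O) := fun s hs => ⟨hs, hy⟩
  exact (hG.hasFDerivWithinAt.comp_hasDerivWithinAt t h1 h2).derivWithin (hJ t ht)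

theorem fderiv_snd {G : ℝ × E → F} {t : ℝ} {y : E}
    (hO : IsOpen O) (ht : t ∈ J) (hy : y ∈ O)
    (hG : DifferentiableWithinAt ℝ G (J ×ˢ O) (t, y)) (ξ : E) :
    fderiv ℝ (fun z => G (t, z)) y ξ = fderivWithin ℝ G (J ×ˢ O) (t, y) (0, ξ) := by
  have h1 : HasFDerivWithinAt (fun z : E => (t, z)) (ContinuousLinearMap.inr ℝ ℝ E) O y :=
    ((hasFDerivAt_const t y).prodMk (hasFDerivAt_id y)).hasFDerivWithinAt
  have h2 := (hG.hasFDerivWithinAt.comp y h1 fun s hs => ⟨ht, hs⟩).hasFDerivAt (hO.mem_nhds hy)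
  exact DFunLike.congr_fun h2.fderiv ξ

theorem contDiffOn_derivWithin_fst {G : ℝ × E → F} (hJ : J.OrdConnected) (hJ' : J.Nontrivial)
    (hO : IsOpen O) (hG : ContDiffOn ℝ ∞ G (J ×ˢ O)) :
    ContDiffOn ℝ ∞ (fun p : ℝ × E => derivWithin (fun s => G (s, p.2)) J p.1) (J ×ˢ O) := by
  have hu := uniqueDiffOn_of_ordConnected hJ hJ'
  have h1 : ContDiffOn ℝ ∞ (fderivWithin ℝ G (J ×ˢ O)) (J ×ˢ O) :=
    hG.fderivWithin (hu.prod hO.uniqueDiffOn) (by simp)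
  refine (h1.clm_apply (contDiffOn_const (c := ((1 : ℝ), (0 : E))))).congr fun p hp => ?_
  exact derivWithin_fst hu hp.1 hp.2 (hG.differentiableOn (by simp) p hp)

/-- Both iterated derivatives are values of the second derivative within J × O on (1, 0) and (0, ξ),
taken in the two orders. -/
theorem fderiv_derivWithin_comm {G : ℝ × E → F} (hJ : J.OrdConnected) (hJ' : J.Nontrivial)
    (hO : IsOpen O) (hG : ContDiffOn ℝ ∞ G (J ×ˢ O)) {t : ℝ} (ht : t ∈ J) {y : E} (hy : y ∈ O)
    (ξ : E) :
    fderiv ℝ (fun z => derivWithin (fun s => G (s, z)) J t) y ξ =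
      derivWithin (fun s => fderiv ℝ (fun z => G (s, z)) y ξ) J t := by
  have hu := uniqueDiffOn_of_ordConnected hJ hJ'
  have hd := hG.differentiableOn (by simp)
  have h1 : ContDiffOn ℝ ∞ (fderivWithin ℝ G (J ×ˢ O)) (J ×ˢ O) :=
    hG.fderivWithin (hu.prod hO.uniqueDiffOn) (by simp)
  have h1d := h1.differentiableOn (by simp) (t, y) ⟨ht, hy⟩
  have hL : (fun z => derivWithin (fun s => G (s, z)) J t) =ᶠ[nhds y]
      fun z => fderivWithin ℝ G (J ×ˢ O) (t, z) (1, 0) := by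
    filter_upwards [hO.mem_nhds hy] with z hz using derivWithin_fst hu ht hz (hd _ ⟨ht, hz⟩)
  have hR : EqOn (fun s => fderiv ℝ (fun z => G (s, z)) y ξ)
      (fun s => fderivWithin ℝ G (J ×ˢ O) (s, y) (0, ξ)) J := fun s hs =>
    fderiv_snd hO hs hy (hd _ ⟨hs, hy⟩) ξ
  rw [hL.fderiv_eq, derivWithin_congr hR (hR ht)]
  have hL2 := fderiv_snd (G := fun p => fderivWithin ℝ G (J ×ˢ O) p (1, 0)) hO ht hy
    (h1d.clm_apply (differentiableWithinAt_const _)) ξ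
  have hR2 := derivWithin_fst (G := fun p => fderivWithin ℝ G (J ×ˢ O) p (0, ξ)) hu ht hy
    (h1d.clm_apply (differentiableWithinAt_const _))
  have huw := (hu.prod hO.uniqueDiffOn) (t, y) ⟨ht, hy⟩
  rw [fderivWithin_clm_apply huw h1d (differentiableWithinAt_const _)] at hL2 hR2
  refine hL2.trans (Eq.trans ?_ hR2.symm)
  have hsymm := ((hG (t, y) ⟨ht, hy⟩).isSymmSndFDerivWithinAt
    (by simpa using (mod_cast le_top : ((2 : ℕ∞) : WithTop ℕ∞) ≤ ∞))
    (hu.prod hO.uniqueDiffOn) (subset_closure_interior_prod hJ hJ' hO ⟨ht, hy⟩) ⟨ht, hy⟩).eq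
      (0, ξ) (1, 0)
  simpa using hsymm

end calculus

variable {n : ℕ} {M : Type*} [TopologicalSpace M] [ChartedSpace (Eucl n) M]
  [IsManifold (𝓡 n) ∞ M] {J : Set ℝ} {u : ℝ → VField n M}

theorem IsSmoothCurve.isSmoothField (hu : IsSmoothCurve J u) {t : ℝ} (ht : t ∈ J) :
    IsSmoothField (u t) := by
  rw [isSmoothField_iff]
  intro c
  exact (hu.contDiffOn c).comp (contDiff_const.prodMk contDiff_id).contDiffOn
    fun y hy => ⟨ht, hy⟩

theorem IsSmoothCurve.contDiffOn_chartVec (hu : IsSmoothCurve J u) (c : M) {y : Eucl n}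
    (hy : y ∈ (chartAt (Eucl n) c).target) :
    ContDiffOn ℝ ∞ (fun s => chartVec c (u s) y) J :=
  (hu.contDiffOn c).comp (contDiff_id.prodMk contDiff_const).contDiffOn fun _ hs => ⟨hs, hy⟩

/-- A curve of tangent vectors at `x` as a curve in the model space. -/
theorem IsSmoothCurve.differentiableOn (hu : IsSmoothCurve J u) (x : M) :
    DifferentiableOn ℝ (F := Eucl n) (fun s => u s x) J := by
  have hx := mem_chart_source (Eucl n) x
  have h := hu.contDiffOn_chartVec x (mem_chart_target _ x)
  have h2 := h.differentiableOn (by simp)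
  let L : Eucl n →L[ℝ] Eucl n :=
    mfderiv 𝓘(ℝ, Eucl n) (𝓡 n) (chartAt (Eucl n) x).symm (chartAt (Eucl n) x x)
  refine (L.differentiable.comp_differentiableOn h2).congr fun s hs => ?_
  have h3 := mfderiv_symm_chartVec x (mem_chart_target _ x) (u s)
  rw [(chartAt (Eucl n) x).left_inv hx] at h3
  exact h3.symm

/-- At a fixed point the curve stays in one tangent space, which is the model space, so a linear map
commutes with the derivative. -/
theorem timeDeriv_apply_clm (hu : IsSmoothCurve J u) (hJ : UniqueDiffOn ℝ J) {t : ℝ} (ht : t ∈ J)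
    (x : M) {F : Type*} [NormedAddCommGroup F] [NormedSpace ℝ F]
    (L : TangentSpace (𝓡 n) x →L[ℝ] F) :
    L (timeDeriv J u t x) = derivWithin (fun s => L (u s x)) J t := by
  have h := (hu.differentiableOn x t ht).hasDerivWithinAt
  let L' : Eucl n →L[ℝ] F := L
  have h2 := (L'.hasFDerivAt.comp_hasDerivWithinAt t h).derivWithin (hJ t ht)
  exact h2.symm

theorem chartVec_timeDeriv (hu : IsSmoothCurve J u) (hJ : UniqueDiffOn ℝ J) {t : ℝ} (ht : t ∈ J)
    (c : M) (y : Eucl n) :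
    chartVec c (timeDeriv J u t) y = derivWithin (fun s => chartVec c (u s) y) J t :=
  timeDeriv_apply_clm hu hJ ht _ (F := Eucl n) _

theorem isSmoothField_timeDeriv (hu : IsSmoothCurve J u) (hJ : J.OrdConnected)
    (hJ' : J.Nontrivial) {t : ℝ} (ht : t ∈ J) : IsSmoothField (timeDeriv J u t) := by
  rw [isSmoothField_iff]
  intro c
  have h := (contDiffOn_derivWithin_fst hJ hJ' (chartAt (Eucl n) c).open_target
    (hu.contDiffOn c)).comp (contDiff_const (c := t).prodMk contDiff_id).contDiffOn
    fun y hy => ⟨ht, hy⟩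
  exact h.congr fun y hy => chartVec_timeDeriv hu (uniqueDiffOn_of_ordConnected hJ hJ') ht c y

variable [RiemannianBundle (fun x : M => TangentSpace (𝓡 n) x)]
  [IsContMDiffRiemannianBundle (𝓡 n) ∞ (Eucl n) (fun x : M => TangentSpace (𝓡 n) x)]

/-- The density does not depend on time, so in the preferred chart at x only the exchange of ∂_t and
∂_i is needed. -/
theorem divergence_timeDeriv (hu : IsSmoothCurve J u) (hJ : J.OrdConnected)
    (hJ' : J.Nontrivial) {t : ℝ} (ht : t ∈ J) (x : M) :
    divergence (timeDeriv J u t) x = derivWithin (fun s => divergence (u s) x) J t := by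
  have huJ := uniqueDiffOn_of_ordConnected hJ hJ'
  set y := chartAt (Eucl n) x x
  have hy : y ∈ (chartAt (Eucl n) x).target := mem_chart_target _ x
  have hO := (chartAt (Eucl n) x).open_target
  have hG : ∀ i : Fin n, ContDiffOn ℝ ∞
      (fun p : ℝ × Eucl n => sqrtGram x p.2 * chartVec x (u p.1) p.2 i)
      (J ×ˢ (chartAt (Eucl n) x).target) := by
    intro i
    refine ((contDiffOn_sqrtGram x).comp contDiffOn_snd fun p hp => hp.2).mul ?_
    exact (EuclideanSpace.proj i : Eucl n →L[ℝ] ℝ).contDiff.comp_contDiffOn (hu.contDiffOn x)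
  have h1 : ∀ i : Fin n, ∀ z, sqrtGram x z * chartVec x (timeDeriv J u t) z i =
      derivWithin (fun s => sqrtGram x z * chartVec x (u s) z i) J t := by
    intro i z
    rw [derivWithin_const_mul_field]
    congr 1
    exact timeDeriv_apply_clm hu huJ ht _ (F := ℝ) ((EuclideanSpace.proj i : Eucl n →L[ℝ] ℝ).comp
      (mfderiv (𝓡 n) 𝓘(ℝ, Eucl n) (chartAt (Eucl n) x) ((chartAt (Eucl n) x).symm z)))
  have h2 : ∀ i : Fin n, DifferentiableWithinAt ℝ (fun s => fderiv ℝ (fun z => sqrtGram x z *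
      chartVec x (u s) z i) y (EuclideanSpace.single i (1 : ℝ))) J t := by
    intro i
    have hd := (hG i).differentiableOn (by simp)
    have h3 : ContDiffOn ℝ ∞ (fderivWithin ℝ (fun p : ℝ × Eucl n => sqrtGram x p.2 *
        chartVec x (u p.1) p.2 i) (J ×ˢ (chartAt (Eucl n) x).target))
        (J ×ˢ (chartAt (Eucl n) x).target) :=
      (hG i).fderivWithin (huJ.prod hO.uniqueDiffOn) (by simp)
    have h4 := (h3.comp (contDiff_id.prodMk contDiff_const).contDiffOn
      fun (s : ℝ) hs => ⟨hs, hy⟩).differentiableOn (by simp) t ht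
    refine (h4.clm_apply (differentiableWithinAt_const
      ((0 : ℝ), (EuclideanSpace.single i (1 : ℝ) : Eucl n)))).congr (fun s hs => ?_) ?_
    · exact fderiv_snd (G := fun p : ℝ × Eucl n => sqrtGram x p.2 * chartVec x (u p.1) p.2 i)
        hO hs hy (hd _ ⟨hs, hy⟩) _
    · exact fderiv_snd (G := fun p : ℝ × Eucl n => sqrtGram x p.2 * chartVec x (u p.1) p.2 i)
        hO ht hy (hd _ ⟨ht, hy⟩) _
  simp only [divergence_def, weightedDiv, h1]
  rw [derivWithin_const_mul_field, derivWithin_fun_sum fun i _ => h2 i]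
  congr 1
  refine Finset.sum_congr rfl fun i _ => ?_
  exact fderiv_derivWithin_comm hJ hJ' hO (hG i) ht hy _

end EulerArnold

end

/-! ### The Riemannian volume and the divergence theorem -/

noncomputable section

namespace EulerArnold

section calculus

/-- Meant for the inverse of a chart, which is continuous only on the target of the chart. -/
theorem measurableSet_inter_preimage_of_continuousOn {X Y : Type*} [TopologicalSpace X]
    [MeasurableSpace X] [OpensMeasurableSpace X] [TopologicalSpace Y] [MeasurableSpace Y]
    [BorelSpace Y] {T : Set X} (hT : MeasurableSet T) {f : X → Y} (hf : ContinuousOn f T)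
    {A : Set Y} (hA : MeasurableSet A) : MeasurableSet (T ∩ f ⁻¹' A) := by
  have h1 : Measurable (T.domRestrict f) := (continuousOn_iff_continuous_domRestrict.1 hf).measurable
  have h2 : T ∩ f ⁻¹' A = Subtype.val '' (T.domRestrict f ⁻¹' A) := by
    ext x
    simp [and_comm]
  rw [h2]
  exact hT.subtype_image (h1 hA)

variable {E : Type*} [NormedAddCommGroup E] [NormedSpace ℝ E] [FiniteDimensional ℝ E]
  [MeasurableSpace E] [BorelSpace E]

/-- Integration by parts against the constant function 1. -/
theorem integral_fderiv_eq_zero {μ : Measure E} [μ.IsAddHaarMeasure] {g : E → ℝ}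
    (hg : ContDiff ℝ 1 g) (hs : HasCompactSupport g) (v : E) : ∫ x, fderiv ℝ g x v ∂μ = 0 := by
  have hc : HasCompactSupport fun x => fderiv ℝ g x v :=
    (hs.fderiv (𝕜 := ℝ)).comp_left (g := fun L : E →L[ℝ] ℝ => L v) rfl
  have hi : Integrable (fun x => fderiv ℝ g x v) μ :=
    ((hg.continuous_fderiv (by simp)).clm_apply continuous_const).integrable_of_hasCompactSupport hc
  have h := integral_mul_fderiv_eq_neg_fderiv_mul_of_integrable (μ := μ) (f := fun _ : E => (1 : ℝ))
    (g := g) (v := v) (by simp) (by simpa using hi)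
    (by simpa using hg.continuous.integrable_of_hasCompactSupport hs)
    (fun x _ => differentiableAt_const _) (fun x _ => hg.differentiable (by simp) x)
  simpa using h

/-- Since g vanishes on T off the compact set K, its extension by zero is C¹ with compact support on
the whole space. -/
theorem setIntegral_fderiv_eq_zero {μ : Measure E} [μ.IsAddHaarMeasure] {g : E → ℝ} {T K : Set E}
    (hT : IsOpen T) (hK : IsCompact K) (hKT : K ⊆ T) (hg : ContDiffOn ℝ 1 g T)
    (h0 : ∀ x ∈ T \ K, g x = 0) (v : E) :
    ∫ x in T, fderiv ℝ g x v ∂μ = 0 ∧ IntegrableOn (fun x => fderiv ℝ g x v) T μ := by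
  have hG0 : ∀ x ∉ K, T.indicator g x = 0 := by
    intro x hx
    by_cases hxT : x ∈ T
    · rw [indicator_of_mem hxT, h0 x ⟨hxT, hx⟩]
    · rw [indicator_of_notMem hxT]
  have hGT : ∀ x ∈ T, T.indicator g =ᶠ[nhds x] g := by
    intro x hx
    filter_upwards [hT.mem_nhds hx] with z hz using indicator_of_mem hz g
  have hGK : ∀ x ∉ K, T.indicator g =ᶠ[nhds x] fun _ => 0 := by
    intro x hx
    filter_upwards [hK.isClosed.isOpen_compl.mem_nhds hx] with z hz using hG0 z hz
  have hG : ContDiff ℝ 1 (T.indicator g) := by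
    rw [contDiff_iff_contDiffAt]
    intro x
    by_cases hx : x ∈ K
    · exact (hg.contDiffAt (hT.mem_nhds (hKT hx))).congr_of_eventuallyEq (hGT x (hKT hx))
    · exact contDiffAt_const.congr_of_eventuallyEq (hGK x hx)
  have hGs : HasCompactSupport (T.indicator g) := HasCompactSupport.intro hK hG0
  have h1 := integral_fderiv_eq_zero (μ := μ) hG hGs v
  have hc : HasCompactSupport fun x => fderiv ℝ (T.indicator g) x v :=
    (hGs.fderiv (𝕜 := ℝ)).comp_left (g := fun L : E →L[ℝ] ℝ => L v) rfl
  have hi : Integrable (fun x => fderiv ℝ (T.indicator g) x v) μ :=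
    ((hG.continuous_fderiv (by simp)).clm_apply continuous_const).integrable_of_hasCompactSupport hc
  have h2 : EqOn (fun x => fderiv ℝ (T.indicator g) x v) (fun x => fderiv ℝ g x v) T :=
    fun x hx => by simp only [(hGT x hx).fderiv_eq]
  refine ⟨?_, hi.integrableOn.congr_fun h2 hT.measurableSet⟩
  rw [← setIntegral_congr_fun hT.measurableSet h2, setIntegral_eq_integral_of_forall_compl_eq_zero,
    h1]
  intro x hx
  rw [(hGK x fun hxK => hx (hKT hxK)).fderiv_eq]
  simp

end calculus

variable {n : ℕ} {M : Type*} [TopologicalSpace M] [ChartedSpace (Eucl n) M]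
  [MeasurableSpace M] [BorelSpace M]
  [RiemannianBundle (fun x : M => TangentSpace (𝓡 n) x)]

omit [RiemannianBundle (fun x : M => TangentSpace (𝓡 n) x)] in
theorem measurableSet_target_inter (c : M) {A : Set M} (hA : MeasurableSet A) :
    MeasurableSet ((chartAt (Eucl n) c).target ∩ (chartAt (Eucl n) c).symm ⁻¹' A) :=
  measurableSet_inter_preimage_of_continuousOn (chartAt (Eucl n) c).open_target.measurableSet
    (chartAt (Eucl n) c).continuousOn_symm hA

omit [RiemannianBundle (fun x : M => TangentSpace (𝓡 n) x)] in
theorem aemeasurable_symm (c : M) : AEMeasurable (chartAt (Eucl n) c).symm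
    ((volume : Measure (Eucl n)).restrict (chartAt (Eucl n) c).target) :=
  (chartAt (Eucl n) c).continuousOn_symm.aemeasurable
    (chartAt (Eucl n) c).open_target.measurableSet

theorem chartVolume_apply (c : M) {A : Set M} (hA : MeasurableSet A) :
    chartVolume (n := n) c A =
      ∫⁻ y in (chartAt (Eucl n) c).target ∩ (chartAt (Eucl n) c).symm ⁻¹' A,
        ENNReal.ofReal (sqrtGram c y) := by
  rw [chartVolume, Measure.map_apply_of_aemeasurable
    ((aemeasurable_symm c).mono_ac (withDensity_absolutelyContinuous _ _)) hA, withDensity_apply',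
    Measure.restrict_restrict' (chartAt (Eucl n) c).open_target.measurableSet, inter_comm]

theorem chartVolume_restrict_source (c : M) :
    (chartVolume (n := n) c).restrict (chartAt (Eucl n) c).source = chartVolume (n := n) c := by
  ext A hA
  have hs := (chartAt (Eucl n) c).open_source.measurableSet
  rw [Measure.restrict_apply hA, chartVolume_apply c (hA.inter hs), chartVolume_apply c hA]
  congr 2
  ext y
  simp only [mem_inter_iff, mem_preimage]
  exact ⟨fun h => ⟨h.1, h.2.1⟩, fun h => ⟨h.1, h.2, (chartAt (Eucl n) c).map_target h.1⟩⟩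

variable [IsManifold (𝓡 n) ∞ M]

/-- The Jacobian in the change of variables is the factor by which the density changes in
`sqrtGram_transition`. -/
theorem chartVolume_eq_of_subset (c c' : M) {A : Set M} (hA : MeasurableSet A)
    (h : A ⊆ (chartAt (Eucl n) c).source) (h' : A ⊆ (chartAt (Eucl n) c').source) :
    chartVolume (n := n) c A = chartVolume (n := n) c' A := by
  rw [chartVolume_apply c hA, chartVolume_apply c' hA]
  set S := (chartAt (Eucl n) c).target ∩ (chartAt (Eucl n) c).symm ⁻¹' A with hS
  have hSO : S ⊆ overlap c c' := fun y hy => ⟨hy.1, h' hy.2⟩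
  have himg : (chartAt (Eucl n) c').target ∩ (chartAt (Eucl n) c').symm ⁻¹' A =
      transition c c' '' S := by
    ext z
    constructor
    · intro hz
      have hz' : z ∈ overlap c' c := ⟨hz.1, h hz.2⟩
      refine ⟨transition c' c z, ⟨transition_mem_target hz', ?_⟩, transition_transition hz'⟩
      rw [mem_preimage, symm_transition hz']
      exact hz.2
    · rintro ⟨y, hy, rfl⟩
      refine ⟨transition_mem_target (hSO hy), ?_⟩
      rw [mem_preimage, symm_transition (hSO hy)]
      exact hy.2
  rw [himg, lintegral_image_eq_lintegral_abs_det_fderiv_mul volume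
    (measurableSet_target_inter c hA)
    (fun y hy => (differentiableAt_transition (hSO hy)).hasFDerivAt.hasFDerivWithinAt)
    ((injOn_transition c c').mono hSO)]
  refine setLIntegral_congr_fun (measurableSet_target_inter c hA) fun y hy => ?_
  rw [← ENNReal.ofReal_mul (abs_nonneg _), sqrtGram_transition (hSO hy)]

/-- On the domain of a chart, the Riemannian volume is given by the density in that chart. -/
theorem riemVolume_restrict_source (c : M) :
    (riemVolume n M).restrict (chartAt (Eucl n) c).source = chartVolume (n := n) c := by
  have hs := (chartAt (Eucl n) c).open_source.measurableSet
  apply le_antisymm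
  · have h1 : riemVolume n M ≤ (riemVolume n M).restrict (chartAt (Eucl n) c).sourceᶜ +
        chartVolume (n := n) c := by
      refine iSup_le fun c' => ?_
      rw [← Measure.restrict_compl_add_restrict (μ := chartVolume (n := n) c') hs]
      refine add_le_add (Measure.restrict_mono_measure (le_iSup (fun c : M => chartVolume c) c') _)
        ?_
      rw [Measure.le_iff]
      intro A hA
      have hs' := (chartAt (Eucl n) c').open_source.measurableSet
      rw [Measure.restrict_apply hA, ← chartVolume_restrict_source c',
        Measure.restrict_apply (hA.inter hs), chartVolume_eq_of_subset c' c
          ((hA.inter hs).inter hs') inter_subset_right (inter_subset_left.trans inter_subset_right)]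
      exact measure_mono (inter_subset_left.trans inter_subset_left)
    have h2 := Measure.restrict_mono_measure h1 (chartAt (Eucl n) c).source
    rwa [Measure.restrict_add, Measure.restrict_restrict hs, inter_compl_self,
      Measure.restrict_empty, zero_add, chartVolume_restrict_source] at h2
  · rw [← chartVolume_restrict_source c]
    exact Measure.restrict_mono_measure (le_iSup (fun c : M => chartVolume c) c) _

variable [IsContMDiffRiemannianBundle (𝓡 n) ∞ (Eucl n) (fun x : M => TangentSpace (𝓡 n) x)]

omit [MeasurableSpace M] [BorelSpace M] in
theorem aemeasurable_density (c : M) :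
    AEMeasurable (fun y => ENNReal.ofReal (sqrtGram (n := n) c y))
      ((volume : Measure (Eucl n)).restrict (chartAt (Eucl n) c).target) :=
  ((contDiffOn_sqrtGram c).continuousOn.aemeasurable
    (chartAt (Eucl n) c).open_target.measurableSet).ennreal_ofReal

theorem setIntegral_riemVolume (c : M) {f : M → ℝ} (hf : Continuous f) :
    ∫ x in (chartAt (Eucl n) c).source, f x ∂(riemVolume n M) =
      ∫ y in (chartAt (Eucl n) c).target, sqrtGram c y * f ((chartAt (Eucl n) c).symm y) := by
  rw [riemVolume_restrict_source, chartVolume, integral_map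
    ((aemeasurable_symm c).mono_ac (withDensity_absolutelyContinuous _ _)) hf.aestronglyMeasurable,
    integral_withDensity_eq_integral_toReal_smul₀ (aemeasurable_density c)
      (Filter.Eventually.of_forall fun y => ENNReal.ofReal_lt_top)]
  refine setIntegral_congr_fun (chartAt (Eucl n) c).open_target.measurableSet fun y hy => ?_
  simp only [smul_eq_mul]
  rw [ENNReal.toReal_ofReal (sqrtGram_pos c hy).le]

/-- Near a point the continuous density is bounded by its value plus 1. On compact `M` this makes
the volume finite and continuous functions integrable. -/
instance isLocallyFiniteMeasure_riemVolume : IsLocallyFiniteMeasure (riemVolume n M) := by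
  refine ⟨fun x => ?_⟩
  have hc := (contDiffOn_sqrtGram x).continuousOn.continuousAt
    ((chartAt (Eucl n) x).open_target.mem_nhds (mem_chart_target _ x))
  obtain ⟨r, hr, hr'⟩ := Metric.eventually_nhds_iff_ball.1
    (hc.eventually (gt_mem_nhds (lt_add_one (sqrtGram x (chartAt (Eucl n) x x)))))
  set B := Metric.ball (chartAt (Eucl n) x x) r with hB
  have hU : IsOpen ((chartAt (Eucl n) x).source ∩ chartAt (Eucl n) x ⁻¹' B) :=
    (chartAt (Eucl n) x).isOpen_inter_preimage Metric.isOpen_ball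
  refine ⟨_, hU.mem_nhds ⟨mem_chart_source _ x, Metric.mem_ball_self hr⟩, ?_⟩
  rw [← Measure.restrict_eq_self _ inter_subset_left, riemVolume_restrict_source,
    chartVolume_apply x hU.measurableSet]
  have hsub : (chartAt (Eucl n) x).target ∩ (chartAt (Eucl n) x).symm ⁻¹'
      ((chartAt (Eucl n) x).source ∩ chartAt (Eucl n) x ⁻¹' B) ⊆ B := by
    rintro y ⟨hy, -, hy'⟩
    rwa [mem_preimage, (chartAt (Eucl n) x).right_inv hy] at hy'
  calc _ ≤ ∫⁻ y in B, ENNReal.ofReal (sqrtGram x y) := lintegral_mono_set hsub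
    _ ≤ ∫⁻ _ in B, ENNReal.ofReal (sqrtGram x (chartAt (Eucl n) x x) + 1) :=
        setLIntegral_mono' measurableSet_ball fun y hy =>
          ENNReal.ofReal_le_ofReal (hr' y hy).le
    _ < ⊤ := by
        rw [setLIntegral_const]
        exact ENNReal.mul_lt_top ENNReal.ofReal_lt_top measure_ball_lt_top

/-- Positivity of the density. It makes a continuous nonnegative function with integral zero vanish
everywhere, and gives μ(M) > 0. -/
instance isOpenPosMeasure_riemVolume : (riemVolume n M).IsOpenPosMeasure := by
  refine ⟨fun U hU hUne h0 => ?_⟩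
  obtain ⟨x, hx⟩ := hUne
  have h1 : chartVolume (n := n) x U = 0 := by
    refine le_antisymm ?_ zero_le
    rw [← h0]
    exact (le_iSup (fun c : M => chartVolume (n := n) c) x) U
  set S := (chartAt (Eucl n) x).target ∩ (chartAt (Eucl n) x).symm ⁻¹' U with hS
  have hSo : IsOpen S := (chartAt (Eucl n) x).symm.isOpen_inter_preimage hU
  have hSne : S.Nonempty := by
    refine ⟨chartAt (Eucl n) x x, mem_chart_target _ x, ?_⟩
    rwa [mem_preimage, (chartAt (Eucl n) x).left_inv (mem_chart_source _ x)]
  rw [chartVolume_apply x hU.measurableSet,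
    lintegral_eq_zero_iff' ((aemeasurable_density x).mono_measure
      (Measure.restrict_mono inter_subset_left le_rfl))] at h1
  have h2 : ∀ᵐ y ∂(volume : Measure (Eucl n)).restrict S, False := by
    filter_upwards [h1, ae_restrict_mem hSo.measurableSet] with y hy hyS
    have := sqrtGram_pos x hyS.1
    simp only [Pi.zero_apply, ENNReal.ofReal_eq_zero] at hy
    linarith
  rw [Filter.eventually_false_iff_eq_bot, ae_eq_bot, Measure.restrict_eq_zero] at h2
  exact (hSo.measure_pos volume hSne).ne' h2

variable [CompactSpace M]

theorem integrable_of_continuous {f : M → ℝ} (hf : Continuous f) :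
    Integrable f (riemVolume n M) :=
  hf.integrable_of_hasCompactSupport (HasCompactSupport.of_compactSpace f)

/-- The divergence of a field supported in the domain of a chart has integral zero. -/
theorem integral_divergence_of_support {w : VField n M} (hw : IsSmoothField w) (c : M)
    {K : Set M} (hK : IsClosed K) (hKc : K ⊆ (chartAt (Eucl n) c).source)
    (h0 : ∀ x ∉ K, w x = 0) (hd : ∀ x ∉ K, divergence w x = 0) :
    ∫ x, divergence w x ∂(riemVolume n M) = 0 := by
  rw [← setIntegral_eq_integral_of_forall_compl_eq_zero (s := (chartAt (Eucl n) c).source)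
    fun x hx => hd x fun hxK => hx (hKc hxK),
    setIntegral_riemVolume c (contMDiff_divergence hw).continuous]
  -- The volume density cancels the factor 1/√G of the divergence; what remains is a sum of
  -- coordinate derivatives of functions vanishing off the image of K.
  have h1 : EqOn (fun y => sqrtGram c y * divergence w ((chartAt (Eucl n) c).symm y))
      (fun y => ∑ i, fderiv ℝ (fun z => sqrtGram c z * chartVec c w z i) y
        (EuclideanSpace.single i (1 : ℝ))) (chartAt (Eucl n) c).target := by
    intro y hy
    simp only [divergence_symm hw c hy, weightedDiv]
    rw [mul_inv_cancel_left₀ (sqrtGram_pos c hy).ne']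
  have h2 := fun i : Fin n => setIntegral_fderiv_eq_zero (μ := (volume : Measure (Eucl n)))
    (g := fun z => sqrtGram c z * chartVec c w z i) (chartAt (Eucl n) c).open_target
    (hK.isCompact.image_of_continuousOn ((chartAt (Eucl n) c).continuousOn.mono hKc))
    (image_subset_iff.2 fun x hx => (chartAt (Eucl n) c).map_source (hKc hx))
    (((contDiffOn_sqrtGram c).mul ((EuclideanSpace.proj i : Eucl n →L[ℝ] ℝ).contDiff.comp_contDiffOn
      ((isSmoothField_iff w).1 hw c))).of_le (by simp))
    (fun y hy => by
      have h3 : w ((chartAt (Eucl n) c).symm y) = 0 :=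
        h0 _ fun hyK => hy.2 ⟨_, hyK, (chartAt (Eucl n) c).right_inv hy.1⟩
      have h4 : chartVec c w y = 0 := by
        rw [chartVec, h3]
        exact map_zero _
      simp [h4])
    (EuclideanSpace.single i (1 : ℝ))
  rw [setIntegral_congr_fun (chartAt (Eucl n) c).open_target.measurableSet h1,
    integral_finsetSum _ fun i _ => (h2 i).2]
  exact Finset.sum_eq_zero fun i _ => (h2 i).1

variable [T2Space M]

/-- The divergence theorem on a closed manifold. -/
theorem integral_divergence {v : VField n M} (hv : IsSmoothField v) :
    ∫ x, divergence v x ∂(riemVolume n M) = 0 := by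
  obtain ⟨χ, hχ⟩ := SmoothPartitionOfUnity.exists_isSubordinate_chartAt_source (𝓡 n) M
  have hfin : {i | (Function.support (χ i)).Nonempty}.Finite :=
    χ.locallyFinite.finite_nonempty_of_compact
  set s := hfin.toFinset
  have hsum : ∀ x, ∑ i ∈ s, χ i x = 1 := by
    intro x
    rw [← χ.sum_eq_one (mem_univ x), finsum_eq_sum_of_support_subset]
    intro i hi
    simp only [s, Finite.coe_toFinset]
    exact ⟨x, hi⟩
  have hχs : ∀ i, ContMDiff (𝓡 n) 𝓘(ℝ, ℝ) ∞ (χ i) := fun i => (χ i).contMDiff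
  have h1 : ∀ x, divergence v x = ∑ i ∈ s, divergence (fun z => χ i z • v z) x := by
    intro x
    simp only [divergence_smul (hχs _) hv, Finset.sum_add_distrib, ← Finset.sum_mul, hsum, one_mul]
    -- The extra terms of the Leibniz rule add up to the derivative of ∑ χ i = 1.
    rw [← dirDeriv_sum_fun s fun i _ => (hχs i).mdifferentiable (by simp) x]
    have h2 : (fun z => ∑ i ∈ s, χ i z) = fun _ => (1 : ℝ) := funext hsum
    have h3 : dirDeriv (fun _ : M => (1 : ℝ)) v x = 0 :=
      DFunLike.congr_fun (mfderiv_const (I := 𝓡 n) (I' := 𝓘(ℝ, ℝ)) (c := (1 : ℝ))) (v x)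
    rw [h2, h3, add_zero]
  simp only [h1]
  rw [integral_finsetSum _ fun i _ =>
    integrable_of_continuous (contMDiff_divergence (hv.smul (hχs i))).continuous]
  refine Finset.sum_eq_zero fun i _ => ?_
  have h0 : ∀ x ∉ tsupport (χ i), χ i x = 0 := fun x hx => image_eq_zero_of_notMem_tsupport hx
  refine integral_divergence_of_support (hv.smul (hχs i)) i (isClosed_tsupport (χ i)) (hχ i)
    (fun x hx => by rw [h0 x hx, zero_smul]) fun x hx => ?_
  have h4 : (χ i : M → ℝ) =ᶠ[nhds x] fun _ => 0 := by
    filter_upwards [(isClosed_tsupport (χ i)).isOpen_compl.mem_nhds hx] with z hz using h0 z hz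
  rw [divergence_smul (hχs i) hv, h0 x hx, zero_mul, zero_add, dirDeriv, h4.mfderiv_eq]
  exact DFunLike.congr_fun (mfderiv_const (I := 𝓡 n) (I' := 𝓘(ℝ, ℝ)) (c := (0 : ℝ))) (v x)

/-- Integration by parts on a closed manifold. -/
theorem integral_mul_divergence {f : M → ℝ} (hf : ContMDiff (𝓡 n) 𝓘(ℝ, ℝ) ∞ f) {v : VField n M}
    (hv : IsSmoothField v) : ∫ x, f x * divergence v x ∂(riemVolume n M) =
      -∫ x, dirDeriv f v x ∂(riemVolume n M) := by
  have h := integral_divergence (hv.smul hf)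
  simp only [divergence_smul hf hv] at h
  have hi : Integrable (fun x => f x * divergence v x) (riemVolume n M) :=
    integrable_of_continuous (hf.continuous.mul (contMDiff_divergence hv).continuous)
  rw [integral_add hi (integrable_of_continuous (contMDiff_dirDeriv hf hv).continuous)] at h
  linarith

end EulerArnold

end

/-! ### Lie brackets, test fields and locally constant functions -/

noncomputable section

namespace EulerArnold

variable {n : ℕ} {M : Type*} [TopologicalSpace M] [ChartedSpace (Eucl n) M]

theorem dirDeriv_const (r : ℝ) (w : VField n M) (x : M) : dirDeriv (fun _ : M => r) w x = 0 :=
  DFunLike.congr_fun (mfderiv_const (I := 𝓡 n) (I' := 𝓘(ℝ, ℝ)) (c := r)) (w x)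

theorem dirDeriv_half_sq {f : M → ℝ} {x : M} (hf : MDifferentiableAt (𝓡 n) 𝓘(ℝ, ℝ) f x)
    (w : VField n M) :
    dirDeriv (fun z => 1 / 2 * f z ^ 2) w x = f x * dirDeriv f w x := by
  simp only [pow_two]
  have hff : MDifferentiableAt (𝓡 n) 𝓘(ℝ, ℝ) (fun z => f z * f z) x := hf.mul hf
  rw [dirDeriv_mul_fun (f := fun _ => (1 / 2 : ℝ)) mdifferentiableAt_const hff,
    dirDeriv_mul_fun hf hf, dirDeriv_const]
  ring

theorem mlieBracket_eq_lieBracket (V W : (y : Eucl n) → TangentSpace 𝓘(ℝ, Eucl n) y)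
    (y : Eucl n) :
    VectorField.mlieBracket 𝓘(ℝ, Eucl n) V W y = VectorField.lieBracket ℝ V W y := by
  have h := congrFun (VectorField.mlieBracketWithin_eq_lieBracketWithin (𝕜 := ℝ) (V := V) (W := W)
    (s := univ)) y
  rw [VectorField.mlieBracketWithin_univ] at h
  exact h.trans (congrFun VectorField.lieBracketWithin_univ y)

variable [IsManifold (𝓡 n) ∞ M]

theorem mpullback_symm_eq (c : M) (v : VField n M) {y : Eucl n}
    (hy : y ∈ (chartAt (Eucl n) c).target) :
    VectorField.mpullback 𝓘(ℝ, Eucl n) (𝓡 n) (chartAt (Eucl n) c).symm v y = chartVec c v y := by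
  have h : (mfderiv 𝓘(ℝ, Eucl n) (𝓡 n) (chartAt (Eucl n) c).symm y).inverse =
      (mfderiv (𝓡 n) 𝓘(ℝ, Eucl n) (chartAt (Eucl n) c) ((chartAt (Eucl n) c).symm y) :
        TangentSpace (𝓡 n) ((chartAt (Eucl n) c).symm y) →L[ℝ] Eucl n) := by
    have h1 := (mdifferentiable_chart (I := 𝓡 n) c).symm_comp_deriv
      ((chartAt (Eucl n) c).map_target hy)
    rw [(chartAt (Eucl n) c).right_inv hy] at h1
    exact ContinuousLinearMap.inverse_eq h1
      ((mdifferentiable_chart (I := 𝓡 n) c).comp_symm_deriv hy)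
  exact DFunLike.congr_fun h _

/-- The bracket commutes with pullback by the inverse chart, and that pullback is `chartVec`. -/
theorem chartVec_mlieBracket {v w : VField n M} (hv : IsSmoothField v) (hw : IsSmoothField w)
    (c : M) {y : Eucl n} (hy : y ∈ (chartAt (Eucl n) c).target) :
    chartVec c (VectorField.mlieBracket (𝓡 n) v w) y =
      fderiv ℝ (chartVec c w) y (chartVec c v y) - fderiv ℝ (chartVec c v) y (chartVec c w y) := by
  have hO := (chartAt (Eucl n) c).open_target.mem_nhds hy
  have h2 : minSmoothness ℝ 2 ≤ ∞ := by
    simpa using (mod_cast le_top : ((2 : ℕ∞) : WithTop ℕ∞) ≤ ∞)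
  have : IsManifold (𝓡 n) (minSmoothness ℝ 2) M := IsManifold.of_le h2
  rw [← mpullback_symm_eq c _ hy, VectorField.mpullback_mlieBracket (n := ∞)
    ((hv _).mdifferentiableAt (by simp)) ((hw _).mdifferentiableAt (by simp))
    ((contMDiffOn_chart_symm (I := 𝓡 n) (n := ∞) (x := c)).contMDiffAt hO) h2]
  have e : ∀ v : VField n M, VectorField.mpullback 𝓘(ℝ, Eucl n) (𝓡 n)
      (chartAt (Eucl n) c).symm v =ᶠ[nhds y] chartVec c v := fun v => by
    filter_upwards [hO] with z hz using mpullback_symm_eq c v hz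
  exact (mlieBracket_eq_lieBracket _ _ y).trans ((e v).lieBracket_vectorField_eq (e w))

theorem isSmoothField_mlieBracket {v w : VField n M} (hv : IsSmoothField v)
    (hw : IsSmoothField w) : IsSmoothField (VectorField.mlieBracket (𝓡 n) v w) := by
  rw [isSmoothField_iff]
  intro c
  have hO := (chartAt (Eucl n) c).open_target
  have hv' := (isSmoothField_iff v).1 hv c
  have hw' := (isSmoothField_iff w).1 hw c
  exact (((hw'.fderiv_of_isOpen (m := ∞) hO (by simp)).clm_apply hv').sub
    ((hv'.fderiv_of_isOpen (m := ∞) hO (by simp)).clm_apply hw')).congr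
    fun y hy => chartVec_mlieBracket hv hw c hy

/-- In a chart the second-derivative terms of f cancel by symmetry, and the first-order terms are
the coordinate formula of the bracket. -/
theorem dirDeriv_mlieBracket {f : M → ℝ} (hf : ContMDiff (𝓡 n) 𝓘(ℝ, ℝ) ∞ f) {v w : VField n M}
    (hv : IsSmoothField v) (hw : IsSmoothField w) (x : M) :
    dirDeriv f (VectorField.mlieBracket (𝓡 n) v w) x =
      dirDeriv (dirDeriv f w) v x - dirDeriv (dirDeriv f v) w x := by
  suffices H : ∀ (c : M) (y : Eucl n), y ∈ (chartAt (Eucl n) c).target →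
      dirDeriv f (VectorField.mlieBracket (𝓡 n) v w) ((chartAt (Eucl n) c).symm y) =
        dirDeriv (dirDeriv f w) v ((chartAt (Eucl n) c).symm y) -
          dirDeriv (dirDeriv f v) w ((chartAt (Eucl n) c).symm y) by
    have h := H x _ (mem_chart_target _ x)
    rwa [(chartAt (Eucl n) x).left_inv (mem_chart_source _ x)] at h
  intro c y hy
  have hO := (chartAt (Eucl n) c).open_target.mem_nhds hy
  have hg := ((contMDiff_iff_forall_chart.1 hf c).contDiffAt hO)
  have hdg := (hg.fderiv_right (m := ∞) (by simp)).differentiableAt (by simp)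
  have key : ∀ a b : VField n M, IsSmoothField a →
      dirDeriv (dirDeriv f a) b ((chartAt (Eucl n) c).symm y) =
        fderiv ℝ (fderiv ℝ fun z => f ((chartAt (Eucl n) c).symm z)) y (chartVec c b y)
          (chartVec c a y) + fderiv ℝ (fun z => f ((chartAt (Eucl n) c).symm z)) y
            (fderiv ℝ (chartVec c a) y (chartVec c b y)) := by
    intro a b ha
    rw [dirDeriv_symm (contMDiff_dirDeriv hf ha) b c hy]
    have h1 : (fun z => dirDeriv f a ((chartAt (Eucl n) c).symm z)) =ᶠ[nhds y] fun z =>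
        fderiv ℝ (fun z => f ((chartAt (Eucl n) c).symm z)) z (chartVec c a z) := by
      filter_upwards [hO] with z hz using dirDeriv_symm hf a c hz
    rw [h1.fderiv_eq, fderiv_clm_apply hdg (ha.differentiableAt c hy)]
    simp [add_comm]
  have hs := (hg.isSymmSndFDerivAt
    (by simpa using (mod_cast le_top : ((2 : ℕ∞) : WithTop ℕ∞) ≤ ∞))).eq
      (chartVec c v y) (chartVec c w y)
  rw [key w v hw, key v w hv, dirDeriv_symm hf _ c hy, chartVec_mlieBracket hv hw c hy, map_sub, hs]
  ring

/-- A local smooth extension is cut off by a bump function supported where it is smooth. -/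
theorem exists_isSmoothField_apply_eq [T2Space M] (x : M) (ξ : TangentSpace (𝓡 n) x) :
    ∃ v : VField n M, IsSmoothField v ∧ v x = ξ := by
  obtain ⟨s, hs, hsm⟩ := FiberBundle.exists_contMDiffOn_extend (k := ∞) (𝓡 n) (Eucl n) ξ
  obtain ⟨ψ, -, hψ⟩ := (SmoothBumpFunction.nhds_basis_tsupport (I := 𝓡 n) x).mem_iff.1
    (interior_mem_nhds.2 hs)
  refine ⟨fun z => ψ z • FiberBundle.extend (Eucl n) ξ z, ?_, ?_⟩
  · exact ContMDiffOn.smul_section_of_tsupport (ψ := ψ) ψ.contMDiff.contMDiffOn isOpen_interior hψ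
      (hsm.mono interior_subset)
  · simp

theorem apply_eq_of_dirDeriv_eq_zero [PreconnectedSpace M] {f : M → ℝ}
    (hf : ContMDiff (𝓡 n) 𝓘(ℝ, ℝ) ∞ f) (h : ∀ (w : VField n M) (x : M), dirDeriv f w x = 0)
    (x x' : M) : f x = f x' := by
  classical
  refine IsLocallyConstant.apply_eq_of_preconnectedSpace
    ((IsLocallyConstant.iff_eventually_eq f).2 fun x => ?_) x x'
  obtain ⟨r, hr, hB⟩ := Metric.mem_nhds_iff.1
    ((chartAt (Eucl n) x).open_target.mem_nhds (mem_chart_target _ x))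
  have hg := contMDiff_iff_forall_chart.1 hf x
  have h1 : ∀ y ∈ Metric.ball (chartAt (Eucl n) x x) r, f ((chartAt (Eucl n) x).symm y) =
      f ((chartAt (Eucl n) x).symm (chartAt (Eucl n) x x)) := by
    intro y hy
    refine Metric.isOpen_ball.is_const_of_fderiv_eq_zero
      (convex_ball _ r).isPreconnected ((hg.mono hB).differentiableOn (by simp)) (𝕜 := ℝ)
      (f := fun y => f ((chartAt (Eucl n) x).symm y)) ?_ hy
      (Metric.mem_ball_self hr)
    intro z hz
    ext1 ξ
    -- The hypothesis covers all fields, smooth or not, so one that is zero off a single point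
    -- suffices.
    let w : VField n M := Function.update (fun _ => 0) ((chartAt (Eucl n) x).symm z)
      (mfderiv 𝓘(ℝ, Eucl n) (𝓡 n) (chartAt (Eucl n) x).symm z ξ)
    have hw : chartVec x w z = ξ := by
      have hwz : w ((chartAt (Eucl n) x).symm z) =
          mfderiv 𝓘(ℝ, Eucl n) (𝓡 n) (chartAt (Eucl n) x).symm z ξ := Function.update_self ..
      rw [chartVec, hwz]
      exact mfderiv_chart_symm x (hB hz) ξ
    rw [← hw, ← dirDeriv_symm hf w x (hB hz), h]
    rfl
  filter_upwards [((chartAt (Eucl n) x).continuousAt (mem_chart_source _ x)).preimage_mem_nhds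
    (Metric.ball_mem_nhds _ hr), chart_source_mem_nhds (Eucl n) x] with z hz hzs
  have h2 := h1 _ hz
  rwa [(chartAt (Eucl n) x).left_inv hzs,
    (chartAt (Eucl n) x).left_inv (mem_chart_source _ x)] at h2

/-! ### The scalar form and the equivalence of the equations -/

variable [MeasurableSpace M] [BorelSpace M] [T2Space M] [CompactSpace M]
  [RiemannianBundle (fun x : M => TangentSpace (𝓡 n) x)]
  [IsContMDiffRiemannianBundle (𝓡 n) ∞ (Eucl n) (fun x : M => TangentSpace (𝓡 n) x)]

/-- Testing with e(f) e, where e is a smooth extension of w(x), gives ∫ e(f)² = 0, and continuity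
makes e(f) vanish at x. -/
theorem dirDeriv_eq_zero_of_integral_eq_zero {f : M → ℝ} (hf : ContMDiff (𝓡 n) 𝓘(ℝ, ℝ) ∞ f)
    (h : ∀ w : VField n M, IsSmoothField w → ∫ x, dirDeriv f w x ∂(riemVolume n M) = 0)
    (w : VField n M) (x : M) : dirDeriv f w x = 0 := by
  obtain ⟨e, he, hex⟩ := exists_isSmoothField_apply_eq x (w x)
  have h1 := h _ (he.smul (contMDiff_dirDeriv hf he))
  simp only [dirDeriv_smul] at h1
  have hc := (contMDiff_dirDeriv hf he).continuous
  rw [integral_eq_zero_iff_of_nonneg (fun z => mul_self_nonneg _)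
    (integrable_of_continuous (hc.mul hc))] at h1
  have h2 := congrFun ((hc.mul hc).ae_eq_iff_eq (riemVolume n M) continuous_const |>.1 h1) x
  have h3 : dirDeriv f e x = 0 := mul_self_eq_zero.1 h2
  rw [dirDeriv, ← hex]
  exact h3

/-- The left side of the scalar form of the equation, with `k` in the place of `u_t`. -/
def scalarForm (v k : VField n M) (x : M) : ℝ :=
  divergence k x + dirDeriv (divergence v) v x + 1 / 2 * divergence v x ^ 2

section scalarForm
variable {v k : VField n M} (hv : IsSmoothField v) (hk : IsSmoothField k)
include hv hk

omit [MeasurableSpace M] [BorelSpace M] [T2Space M] [CompactSpace M] in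
theorem contMDiff_scalarForm : ContMDiff (𝓡 n) 𝓘(ℝ, ℝ) ∞ (scalarForm v k) :=
  ((contMDiff_divergence hk).add (contMDiff_dirDeriv (contMDiff_divergence hv) hv)).add
    (contMDiff_const.mul ((contMDiff_divergence hv).pow 2))

omit [MeasurableSpace M] [BorelSpace M] [T2Space M] [CompactSpace M] in
theorem dirDeriv_scalarForm (w : VField n M) (x : M) :
    dirDeriv (scalarForm v k) w x = dirDeriv (divergence k) w x +
      dirDeriv (dirDeriv (divergence v) v) w x + divergence v x * dirDeriv (divergence v) w x := by
  have h1 := (contMDiff_divergence hk).mdifferentiable (by simp) x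
  have h2 := (contMDiff_divergence hv).mdifferentiable (by simp) x
  have h3 := (contMDiff_dirDeriv (contMDiff_divergence hv) hv).mdifferentiable (by simp) x
  have h4 : MDifferentiableAt (𝓡 n) 𝓘(ℝ, ℝ) (fun z => 1 / 2 * divergence v z ^ 2) x :=
    (contMDiff_const.mul ((contMDiff_divergence hv).pow 2)).mdifferentiable (n := ∞) (by simp) x
  have h5 : MDifferentiableAt (𝓡 n) 𝓘(ℝ, ℝ)
      (fun z => divergence k z + dirDeriv (divergence v) v z) x := h1.add h3
  rw [← dirDeriv_half_sq h2, ← dirDeriv_add_fun h1 h3, ← dirDeriv_add_fun h5 h4]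
  rfl

/-- Each divergence involving w is moved off by parts. The bracket leaves v(w h) - w(v h), and a
further integration by parts replaces ∫ v(w h) by -∫ h w(h), the source of the term ½ h². -/
theorem h1Inner_adj_sub {w : VField n M} (hw : IsSmoothField w) :
    h1Inner v (adj v w) - h1Inner (fun x => -k x) w =
      -(1 / 4) * ∫ x, dirDeriv (scalarForm v k) w x ∂(riemVolume n M) := by
  have hh := contMDiff_divergence hv
  have hhw := contMDiff_dirDeriv hh hw
  have hhv := contMDiff_dirDeriv hh hv
  have e1 : h1Inner v (adj v w) = -(1 / 4) * ∫ x, divergence v x *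
      divergence (VectorField.mlieBracket (𝓡 n) v w) x ∂(riemVolume n M) := by
    rw [h1Inner, neg_mul, ← mul_neg, ← integral_neg]
    congr 2
    ext x
    rw [← mul_neg, ← divergence_neg]
    rfl
  have e2 : h1Inner (fun x => -k x) w = -(1 / 4) * ∫ x, divergence k x * divergence w x
      ∂(riemVolume n M) := by
    rw [h1Inner, neg_mul, ← mul_neg, ← integral_neg]
    congr 2
    ext x
    rw [divergence_neg, neg_mul]
  have i1 := integrable_of_continuous (n := n) (contMDiff_dirDeriv hhw hv).continuous
  have i2 := integrable_of_continuous (n := n) (contMDiff_dirDeriv hhv hw).continuous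
  have i3 := integrable_of_continuous (n := n) (contMDiff_dirDeriv (contMDiff_divergence hk) hw).continuous
  have i4 : Integrable (fun x => divergence v x * dirDeriv (divergence v) w x) (riemVolume n M) :=
    integrable_of_continuous (hh.continuous.mul hhw.continuous)
  -- This is the further integration by parts, with the function w(h) and the field v.
  have e3 := integral_mul_divergence hhw hv
  have e4 : ∫ x, dirDeriv (divergence v) w x * divergence v x ∂(riemVolume n M) =
      ∫ x, divergence v x * dirDeriv (divergence v) w x ∂(riemVolume n M) := by
    simp only [mul_comm]
  rw [e1, e2, integral_mul_divergence hh (isSmoothField_mlieBracket hv hw),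
    integral_mul_divergence (contMDiff_divergence hk) hw]
  simp only [dirDeriv_mlieBracket hh hv hw, dirDeriv_scalarForm hv hk]
  have i32 : Integrable (fun x => dirDeriv (divergence k) w x +
      dirDeriv (dirDeriv (divergence v) v) w x) (riemVolume n M) := i3.add i2
  rw [integral_sub i1 i2, integral_add i32 i4, integral_add i3 i2]
  linarith

theorem isAdTranspose_iff : IsAdTranspose h1Inner v v (fun x => -k x) ↔
    ∀ (w : VField n M) (x : M), dirDeriv (scalarForm v k) w x = 0 := by
  constructor
  · intro h
    refine dirDeriv_eq_zero_of_integral_eq_zero (contMDiff_scalarForm hv hk) fun w hw => ?_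
    have h1 := h1Inner_adj_sub hv hk hw
    rw [h w hw, sub_self] at h1
    linarith
  · intro h w hw
    have h1 := h1Inner_adj_sub hv hk hw
    simp only [h, integral_zero, mul_zero] at h1
    linarith

/-- A constant S equals its mean, and ∫ S = 0 - ∫ h² + ½ ∫ h² by the divergence theorem. -/
theorem scalarForm_eq_iff [ConnectedSpace M] :
    (∀ x, scalarForm v k x = -(1 / (2 * (riemVolume n M univ).toReal)) *
      ∫ z, divergence v z ^ 2 ∂(riemVolume n M)) ↔
    ∀ (w : VField n M) (x : M), dirDeriv (scalarForm v k) w x = 0 := by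
  constructor
  · intro h w x
    rw [funext h, dirDeriv_const]
  · intro h x
    have hc := apply_eq_of_dirDeriv_eq_zero (contMDiff_scalarForm hv hk) h
    have hh := contMDiff_divergence hv
    have i1 := integrable_of_continuous (n := n) (contMDiff_divergence hk).continuous
    have i2 := integrable_of_continuous (n := n) (contMDiff_dirDeriv hh hv).continuous
    have i3 : Integrable (fun x => 1 / 2 * divergence v x ^ 2) (riemVolume n M) :=
      integrable_of_continuous (continuous_const.mul (hh.continuous.pow 2))
    have i12 : Integrable (fun x => divergence k x + dirDeriv (divergence v) v x)
      (riemVolume n M) := i1.add i2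
    have h1 : ∫ z, scalarForm v k z ∂(riemVolume n M) =
        -(1 / 2) * ∫ z, divergence v z ^ 2 ∂(riemVolume n M) := by
      have e := integral_mul_divergence hh hv
      simp only [scalarForm]
      rw [integral_add i12 i3, integral_add i1 i2, integral_divergence hk, integral_const_mul]
      simp only [← pow_two] at e
      linarith
    have h2 : ∫ z, scalarForm v k z ∂(riemVolume n M) =
        (riemVolume n M univ).toReal * scalarForm v k x := by
      simp only [hc _ x, integral_const, smul_eq_mul, Measure.real]
    have h3 : 0 < (riemVolume n M univ).toReal :=
      ENNReal.toReal_pos (isOpen_univ.measure_pos _ univ_nonempty).ne' (measure_ne_top _ _)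
    rw [h2] at h1
    field_simp
    linarith

omit [MeasurableSpace M] [BorelSpace M] [T2Space M] [CompactSpace M] in
-- The left side is the gradient of the scalar form, the middle term being ∇(½ h²).
theorem grad_eq_zero_iff (x : M) :
    grad (n := n) (divergence k) x + divergence v x • grad (divergence v) x
      + grad (fun z => inner ℝ (v z) (grad (divergence v) z)) x = 0 ↔
    ∀ w : VField n M, dirDeriv (scalarForm v k) w x = 0 := by
  have e1 : (fun z => inner ℝ (v z) (grad (divergence v) z)) = dirDeriv (divergence v) v := by
    ext z
    rw [real_inner_comm, inner_grad]
    rfl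
  have e2 : ∀ w : VField n M, inner ℝ (grad (n := n) (divergence k) x +
      divergence v x • grad (divergence v) x +
      grad (fun z => inner ℝ (v z) (grad (divergence v) z)) x) (w x) =
      dirDeriv (scalarForm v k) w x := by
    intro w
    have e3 : ∀ f : M → ℝ, inner ℝ (grad f x) (w x) = dirDeriv f w x := fun f =>
      inner_grad f x (w x)
    rw [e1, dirDeriv_scalarForm hv hk, inner_add_left, inner_add_left, real_inner_smul_left,
      e3, e3, e3]
    ring
  classical
  constructor
  · intro h w
    rw [← e2, h, inner_zero_left]
  · intro h
    refine ext_inner_right ℝ fun ξ => ?_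
    have := e2 (Function.update (fun _ => 0) x ξ)
    rw [Function.update_self, h] at this
    rw [this, inner_zero_left]

end scalarForm

section curve
variable {J : Set ℝ} {u : ℝ → VField n M}

theorem eulerArnoldEquation_iff (hJ : J.OrdConnected) (hJ' : J.Nontrivial)
    (hu : IsSmoothCurve J u) : EulerArnoldEquation h1Inner J u ↔ ∀ t ∈ J, ∀ (x : M)
      (w : VField n M), dirDeriv (scalarForm (u t) (timeDeriv J u t)) w x = 0 := by
  refine forall₂_congr fun t ht => ?_
  rw [isAdTranspose_iff (hu.isSmoothField ht) (isSmoothField_timeDeriv hu hJ hJ' ht)]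
  exact forall_comm

omit [MeasurableSpace M] [BorelSpace M] [T2Space M] [CompactSpace M] in
theorem gradientEquation_iff (hJ : J.OrdConnected) (hJ' : J.Nontrivial)
    (hu : IsSmoothCurve J u) : GradientEquation J u ↔ ∀ t ∈ J, ∀ (x : M)
      (w : VField n M), dirDeriv (scalarForm (u t) (timeDeriv J u t)) w x = 0 :=
  forall₂_congr fun _ ht => forall_congr' fun x =>
    grad_eq_zero_iff (hu.isSmoothField ht) (isSmoothField_timeDeriv hu hJ hJ' ht) x

theorem densityEquation_iff [ConnectedSpace M] (hJ : J.OrdConnected) (hJ' : J.Nontrivial)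
    (hu : IsSmoothCurve J u) : DensityEquation J u (fun t => divergence (u t)) ↔
      ∀ t ∈ J, ∀ (x : M) (w : VField n M),
        dirDeriv (scalarForm (u t) (timeDeriv J u t)) w x = 0 := by
  refine forall₂_congr fun t ht => ?_
  rw [forall_comm, ← scalarForm_eq_iff (hu.isSmoothField ht)
    (isSmoothField_timeDeriv hu hJ hJ' ht)]
  refine forall_congr' fun x => ?_
  rw [scalarForm, divergence_timeDeriv hu hJ hJ' ht, real_inner_comm, inner_grad]
  rfl

end curve

end EulerArnold

end

/-! ### Dimension one and the Hunter-Saxton equation -/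

noncomputable section

namespace EulerArnold

section chart
variable {n : ℕ} {M : Type*} [TopologicalSpace M] [ChartedSpace (Eucl n) M]
  [IsManifold (𝓡 n) ∞ M] [RiemannianBundle (fun x : M => TangentSpace (𝓡 n) x)]

theorem inner_eq_chartMetric (c : M) {x : M} (hx : x ∈ (chartAt (Eucl n) c).source)
    (ξ η : TangentSpace (𝓡 n) x) :
    inner ℝ ξ η = chartMetric c (chartAt (Eucl n) c x)
      (mfderiv (𝓡 n) 𝓘(ℝ, Eucl n) (chartAt (Eucl n) c) x ξ)
      (mfderiv (𝓡 n) 𝓘(ℝ, Eucl n) (chartAt (Eucl n) c) x η) := by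
  obtain ⟨y, hy, rfl⟩ : ∃ y ∈ (chartAt (Eucl n) c).target, (chartAt (Eucl n) c).symm y = x :=
    ⟨_, (chartAt (Eucl n) c).map_source hx, (chartAt (Eucl n) c).left_inv hx⟩
  have h : ∀ ξ : TangentSpace (𝓡 n) ((chartAt (Eucl n) c).symm y),
      mfderiv 𝓘(ℝ, Eucl n) (𝓡 n) (chartAt (Eucl n) c).symm y
        (mfderiv (𝓡 n) 𝓘(ℝ, Eucl n) (chartAt (Eucl n) c) ((chartAt (Eucl n) c).symm y) ξ) = ξ := by
    intro ξ
    have h := mfderiv_symm_chart c hx ξ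
    rw [(chartAt (Eucl n) c).right_inv hy] at h
    exact h
  rw [(chartAt (Eucl n) c).right_inv hy]
  exact (congrArg₂ (inner ℝ) (h ξ) (h η)).symm

omit [IsManifold (𝓡 n) ∞ M] [RiemannianBundle (fun x : M => TangentSpace (𝓡 n) x)] in
theorem mfderiv_chart_eq_chartVec (c : M) {x : M} (hx : x ∈ (chartAt (Eucl n) c).source)
    (v : VField n M) : (mfderiv (𝓡 n) 𝓘(ℝ, Eucl n) (chartAt (Eucl n) c) x (v x) : Eucl n) =
      chartVec c v (chartAt (Eucl n) c x) := by
  rw [chartVec, (chartAt (Eucl n) c).left_inv hx]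

end chart

variable {M : Type*} [TopologicalSpace M] [ChartedSpace (Eucl 1) M]
  [IsManifold (𝓡 1) ∞ M] [RiemannianBundle (fun x : M => TangentSpace (𝓡 1) x)]

theorem eq_smul_single (ξ : Eucl 1) : ξ = ξ 0 • EuclideanSpace.single 0 (1 : ℝ) := by
  ext i
  fin_cases i
  simp

/-- The Gram matrix has a single entry, which is therefore its determinant. -/
theorem chartMetric_eq_mul (c : M) {y : Eucl 1} (hy : y ∈ (chartAt (Eucl 1) c).target)
    (ξ η : Eucl 1) : chartMetric c y ξ η = ξ 0 * η 0 * sqrtGram c y ^ 2 := by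
  rw [sqrtGram, Real.sq_sqrt (det_gram_pos c hy).le, Matrix.det_fin_one]
  conv_lhs => rw [eq_smul_single ξ, eq_smul_single η]
  rw [map_smul, map_smul, LinearMap.smul_apply, smul_eq_mul, smul_eq_mul, ← mul_assoc,
    mul_comm (η 0)]
  rfl

theorem inner_eq_mul (c : M) {x : M} (hx : x ∈ (chartAt (Eucl 1) c).source)
    {ξ η : TangentSpace (𝓡 1) x} {a b : Eucl 1}
    (ha : (mfderiv (𝓡 1) 𝓘(ℝ, Eucl 1) (chartAt (Eucl 1) c) x ξ : Eucl 1) = a)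
    (hb : (mfderiv (𝓡 1) 𝓘(ℝ, Eucl 1) (chartAt (Eucl 1) c) x η : Eucl 1) = b) :
    inner ℝ ξ η = a 0 * b 0 * sqrtGram c (chartAt (Eucl 1) c x) ^ 2 := by
  subst ha hb
  exact (inner_eq_chartMetric c hx ξ η).trans
    (chartMetric_eq_mul c ((chartAt (Eucl 1) c).map_source hx) _ _)

omit [TopologicalSpace M] [ChartedSpace (Eucl 1) M] [IsManifold (𝓡 1) ∞ M]
  [RiemannianBundle (fun x : M => TangentSpace (𝓡 1) x)] in
theorem hasDerivAt_of_hasMFDerivAt {F : Type*} [NormedAddCommGroup F] [NormedSpace ℝ F]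
    {g : ℝ → F} {g' : ℝ →L[ℝ] F} {s : ℝ} (h : HasMFDerivAt 𝓘(ℝ, ℝ) 𝓘(ℝ, F) g s g') :
    HasDerivAt g (g' 1) s := by
  have h1 : HasFDerivAt (𝕜 := ℝ) (E := ℝ) (F := F) g g' s := hasMFDerivAt_iff_hasFDerivAt.1 h
  exact h1.hasDerivAt

omit [IsManifold (𝓡 1) ∞ M] in
theorem IsArcLengthParam.hasDerivAt_comp {γ : ℝ → M} (hγ : IsArcLengthParam 1 γ) {f : M → ℝ}
    (hf : ContMDiff (𝓡 1) 𝓘(ℝ, ℝ) ∞ f) (s : ℝ) :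
    HasDerivAt (fun s => f (γ s))
      (mfderiv (𝓡 1) 𝓘(ℝ, ℝ) f (γ s) (mfderiv 𝓘(ℝ, ℝ) (𝓡 1) γ s (1 : ℝ))) s := by
  exact hasDerivAt_of_hasMFDerivAt ((hf.mdifferentiable (by simp) (γ s)).hasMFDerivAt.comp s
    (hγ.smooth.mdifferentiable (by simp) s).hasMFDerivAt)

omit [IsManifold (𝓡 1) ∞ M] in
theorem IsArcLengthParam.contDiff_comp {γ : ℝ → M} (hγ : IsArcLengthParam 1 γ) {f : M → ℝ}
    (hf : ContMDiff (𝓡 1) 𝓘(ℝ, ℝ) ∞ f) : ContDiff ℝ ∞ fun s => f (γ s) :=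
  (hf.comp hγ.smooth).contDiff

omit [IsManifold (𝓡 1) ∞ M] in
theorem IsArcLengthParam.apply_eq_smul {γ : ℝ → M} (hγ : IsArcLengthParam 1 γ) (w : VField 1 M)
    (s : ℝ) : w (γ s) = componentAlong γ w s • mfderiv 𝓘(ℝ, ℝ) (𝓡 1) γ s (1 : ℝ) := by
  have h1 := hγ.unit_speed s
  have hne : (mfderiv 𝓘(ℝ, ℝ) (𝓡 1) γ s (1 : ℝ) : TangentSpace (𝓡 1) (γ s)) ≠ 0 := by
    intro h
    rw [h, norm_zero] at h1
    exact zero_ne_one h1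
  have hfr : Module.finrank ℝ (TangentSpace (𝓡 1) (γ s)) = 1 :=
    finrank_euclideanSpace_fin (𝕜 := ℝ) (n := 1)
  obtain ⟨r, hr⟩ := (finrank_eq_one_iff_of_nonzero' _ hne).1 hfr (w (γ s))
  have h2 : componentAlong γ w s = r := by
    rw [componentAlong, ← hr, real_inner_smul_left, real_inner_self_eq_norm_sq, h1]
    ring
  rw [h2, hr]

omit [IsManifold (𝓡 1) ∞ M] in
theorem IsArcLengthParam.dirDeriv_eq {γ : ℝ → M} (hγ : IsArcLengthParam 1 γ) {f : M → ℝ}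
    (hf : ContMDiff (𝓡 1) 𝓘(ℝ, ℝ) ∞ f) (w : VField 1 M) (s : ℝ) :
    dirDeriv f w (γ s) = componentAlong γ w s * deriv (fun s => f (γ s)) s := by
  rw [(hγ.hasDerivAt_comp hf s).deriv, dirDeriv, hγ.apply_eq_smul w s]
  exact (mfderiv (𝓡 1) 𝓘(ℝ, ℝ) f (γ s)).map_smul _ _

omit [IsManifold (𝓡 1) ∞ M] in
theorem IsArcLengthParam.dirDeriv_eq_zero_iff {γ : ℝ → M} (hγ : IsArcLengthParam 1 γ) {f : M → ℝ}
    (hf : ContMDiff (𝓡 1) 𝓘(ℝ, ℝ) ∞ f) :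
    (∀ (x : M) (w : VField 1 M), dirDeriv f w x = 0) ↔ ∀ s, deriv (fun s => f (γ s)) s = 0 := by
  classical
  constructor
  · intro h s
    have h1 := h (γ s) (Function.update (fun _ => 0) (γ s) (mfderiv 𝓘(ℝ, ℝ) (𝓡 1) γ s (1 : ℝ)))
    rw [hγ.dirDeriv_eq hf, componentAlong, Function.update_self, real_inner_self_eq_norm_sq,
      hγ.unit_speed s] at h1
    simpa using h1
  · intro h x w
    obtain ⟨s, rfl⟩ := hγ.surjective x
    rw [hγ.dirDeriv_eq hf, h, mul_zero]

variable [IsContMDiffRiemannianBundle (𝓡 1) ∞ (Eucl 1) (fun x : M => TangentSpace (𝓡 1) x)]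

/-- In dimension one, the divergence is the derivative of the component along an arc length
parametrization. -/
theorem IsArcLengthParam.hasDerivAt_componentAlong {γ : ℝ → M} (hγ : IsArcLengthParam 1 γ)
    {v : VField 1 M} (hv : IsSmoothField v) (s₀ : ℝ) :
    HasDerivAt (componentAlong γ v) (divergence v (γ s₀)) s₀ := by
  set c := γ s₀
  set y : ℝ → Eucl 1 := fun s => chartAt (Eucl 1) c (γ s) with hy
  set U := γ ⁻¹' (chartAt (Eucl 1) c).source with hU
  have hUo : IsOpen U := (chartAt (Eucl 1) c).open_source.preimage hγ.smooth.continuous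
  have hs₀ : s₀ ∈ U := mem_chart_source _ c
  have hUn := hUo.mem_nhds hs₀
  have hyt : ∀ s ∈ U, y s ∈ (chartAt (Eucl 1) c).target := fun s hs =>
    (chartAt (Eucl 1) c).map_source hs
  have hys : ContDiffOn ℝ ∞ y U := by
    rw [← contMDiffOn_iff_contDiffOn]
    exact (contMDiffOn_chart (I := 𝓡 1) (n := ∞) (x := c)).comp hγ.smooth.contMDiffOn
      fun s hs => hs
  have hyd : ∀ s ∈ U, HasDerivAt y (mfderiv (𝓡 1) 𝓘(ℝ, Eucl 1) (chartAt (Eucl 1) c) (γ s)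
      (mfderiv 𝓘(ℝ, ℝ) (𝓡 1) γ s (1 : ℝ))) s := by
    intro s hs
    exact hasDerivAt_of_hasMFDerivAt
      (((mdifferentiable_chart (I := 𝓡 1) c).mdifferentiableAt hs).hasMFDerivAt.comp s
        (hγ.smooth.mdifferentiable (by simp) s).hasMFDerivAt)
  have hcomp : ∀ s ∈ U, componentAlong γ v s =
      chartVec c v (y s) 0 * deriv y s 0 * sqrtGram c (y s) ^ 2 := by
    intro s hs
    exact inner_eq_mul c hs (mfderiv_chart_eq_chartVec c hs v) (hyd s hs).deriv.symm
  have hunit : ∀ s ∈ U, (deriv y s 0 * sqrtGram c (y s)) ^ 2 = 1 := by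
    intro s hs
    have h1 := real_inner_self_eq_norm_sq
      (mfderiv 𝓘(ℝ, ℝ) (𝓡 1) γ s (1 : ℝ) : TangentSpace (𝓡 1) (γ s))
    rw [hγ.unit_speed s, inner_eq_mul c hs (hyd s hs).deriv.symm (hyd s hs).deriv.symm] at h1
    rw [mul_pow, pow_two (deriv y s 0), h1, one_pow]
  have hcont : ContinuousAt (fun s => deriv y s 0 * sqrtGram c (y s)) s₀ := by
    have h1 : ContinuousAt (deriv y) s₀ :=
      ((hys.deriv_of_isOpen (m := ∞) hUo (by simp)).continuousOn).continuousAt hUn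
    have h2 : ContinuousAt (sqrtGram (n := 1) c) (y s₀) :=
      (differentiableAt_sqrtGram c (hyt s₀ hs₀)).continuousAt
    exact ((EuclideanSpace.proj 0 : Eucl 1 →L[ℝ] ℝ).continuous.continuousAt.comp h1).mul
      (h2.comp (hyd s₀ hs₀).continuousAt)
  set ε := deriv y s₀ 0 * sqrtGram c (y s₀) with hε
  -- The function is continuous with square 1. Where it is within distance 1 of ε = ±1 it cannot be
  -- -ε, so its sign, the orientation of γ in the chart, is locally constant.
  have hconst : ∀ᶠ s in nhds s₀, deriv y s 0 * sqrtGram c (y s) = ε := by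
    filter_upwards [hcont.eventually (Metric.ball_mem_nhds _ one_pos), hUn] with s hs hsU
    have h1 := hunit s hsU
    have h2 := hunit s₀ hs₀
    rw [← hε] at h2
    rw [Real.dist_eq, ← hε] at hs
    rw [← h2, sq_eq_sq_iff_eq_or_eq_neg] at h1
    rcases h1 with h1 | h1
    · exact h1
    · rw [← sq_abs] at h2
      rw [h1, ← neg_add', abs_neg, ← two_mul, abs_mul, abs_two,
        (pow_eq_one_iff_of_nonneg (abs_nonneg ε) two_ne_zero).1 h2] at hs
      norm_num at hs
  -- The metric coefficient is the square of the density; one of its two factors combines with y'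
  -- into ε.
  have hev : componentAlong γ v =ᶠ[nhds s₀]
      fun s => ε * (sqrtGram c (y s) * chartVec c v (y s) 0) := by
    filter_upwards [hconst, hUn] with s hs hsU
    rw [hcomp s hsU, ← hs]
    ring
  have hg : DifferentiableAt ℝ (fun z => sqrtGram c z * chartVec c v z 0) (y s₀) :=
    (differentiableAt_sqrtGram c (hyt s₀ hs₀)).mul
      ((EuclideanSpace.proj 0 : Eucl 1 →L[ℝ] ℝ).differentiableAt.comp _
        (hv.differentiableAt c (hyt s₀ hs₀)))
  have hd := ((hg.hasFDerivAt.comp_hasDerivAt s₀ (hyd s₀ hs₀)).const_mul ε).congr_of_eventuallyEq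
    hev
  convert! hd using 1
  rw [← (hyd s₀ hs₀).deriv, eq_smul_single (deriv y s₀), map_smul, smul_eq_mul, divergence_def,
    weightedDiv, Fin.sum_univ_one]
  have h0 := (sqrtGram_pos c (hyt s₀ hs₀)).ne'
  have h1 := hunit s₀ hs₀
  -- The orientation enters twice and cancels: ε y' = (y')² √G, and (y' √G)² = 1.
  have h2 : ε * deriv y s₀ 0 = (sqrtGram c (y s₀))⁻¹ := by
    rw [hε]
    field_simp
    linarith
  rw [← mul_assoc, h2]

section HunterSaxton
variable {J : Set ℝ} {u : ℝ → VField 1 M}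

/-- With f and g the components of v and k, S ∘ γ = g' + f f'' + ½ f'². The product rule and the
square each contribute f' f'', hence the coefficient 2. -/
theorem IsArcLengthParam.deriv_scalarForm {γ : ℝ → M} (hγ : IsArcLengthParam 1 γ)
    {v k : VField 1 M} (hv : IsSmoothField v) (hk : IsSmoothField k) (s : ℝ) :
    deriv (fun s => scalarForm v k (γ s)) s =
      iteratedDeriv 2 (componentAlong γ k) s +
        2 * deriv (componentAlong γ v) s * iteratedDeriv 2 (componentAlong γ v) s +
        componentAlong γ v s * iteratedDeriv 3 (componentAlong γ v) s := by
  have d1 : ∀ {w : VField 1 M}, IsSmoothField w →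
      deriv (componentAlong γ w) = fun s => divergence w (γ s) := fun hw =>
    funext fun s => (hγ.hasDerivAt_componentAlong hw s).deriv
  have hK := hγ.contDiff_comp (contMDiff_divergence hk)
  have hH := hγ.contDiff_comp (contMDiff_divergence hv)
  have hH' : ContDiff ℝ ∞ (deriv fun s => divergence v (γ s)) :=
    (contDiff_infty_iff_deriv.1 hH).2
  have e : (fun s => scalarForm v k (γ s)) = fun s => divergence k (γ s) +
      componentAlong γ v s * deriv (fun s => divergence v (γ s)) s +
      1 / 2 * divergence v (γ s) ^ 2 := by
    ext s
    rw [scalarForm, hγ.dirDeriv_eq (contMDiff_divergence hv)]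
  have h1 := (hK.differentiable (by simp) s).hasDerivAt
  have h2 := (hH.differentiable (by simp) s).hasDerivAt
  have h3 := (hH'.differentiable (by simp) s).hasDerivAt
  have h4 := (h1.add ((hγ.hasDerivAt_componentAlong hv s).mul h3)).add ((h2.pow 2).const_mul (1 / 2))
  rw [e, iteratedDeriv_succ, iteratedDeriv_succ', iteratedDeriv_succ', iteratedDeriv_succ',
    iteratedDeriv_succ', iteratedDeriv_succ']
  simp only [iteratedDeriv_zero, d1 hv, d1 hk]
  refine h4.deriv.trans ?_
  simp
  ring

omit [IsContMDiffRiemannianBundle (𝓡 1) ∞ (Eucl 1) (fun x : M => TangentSpace (𝓡 1) x)] in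
theorem derivWithin_componentAlong {γ : ℝ → M} (hu : IsSmoothCurve J u)
    (hJ : UniqueDiffOn ℝ J) {t : ℝ} (ht : t ∈ J) (s : ℝ) :
    derivWithin (fun r => componentAlong γ (u r) s) J t =
      componentAlong γ (timeDeriv J u t) s := by
  have h := timeDeriv_apply_clm hu hJ ht (γ s) (innerSL ℝ (mfderiv 𝓘(ℝ, ℝ) (𝓡 1) γ s (1 : ℝ) :
    TangentSpace (𝓡 1) (γ s)))
  simp only [componentAlong]
  rw [real_inner_comm]
  refine Eq.trans ?_ h.symm
  congr 1
  ext r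
  exact real_inner_comm _ _

theorem IsArcLengthParam.eulerArnoldEquation_iff [MeasurableSpace M] [BorelSpace M] [T2Space M]
    [CompactSpace M] {γ : ℝ → M} (hγ : IsArcLengthParam 1 γ)
    (hJ : J.OrdConnected) (hJ' : J.Nontrivial) (hu : IsSmoothCurve J u) :
    EulerArnoldEquation h1Inner J u ↔
      HunterSaxtonEquation J fun t => componentAlong γ (u t) := by
  rw [EulerArnold.eulerArnoldEquation_iff hJ hJ' hu]
  refine forall₂_congr fun t ht => ?_
  have hv := hu.isSmoothField ht
  have hk := isSmoothField_timeDeriv hu hJ hJ' ht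
  rw [hγ.dirDeriv_eq_zero_iff (contMDiff_scalarForm hv hk)]
  refine forall_congr' fun s => ?_
  simp only [hγ.deriv_scalarForm hv hk, derivWithin_componentAlong hu
    (uniqueDiffOn_of_ordConnected hJ hJ') ht]

end HunterSaxton

end EulerArnold

end

/-! ### The main theorem -/

theorem mainTheorem6 {n : ℕ} {M : Type*} [TopologicalSpace M] [ChartedSpace (EuclideanSpace ℝ (Fin n)) M]
    [IsManifold (𝓡 n) ∞ M] [T2Space M] [CompactSpace M] [ConnectedSpace M]
    [MeasurableSpace M] [BorelSpace M]
    [RiemannianBundle (fun x : M => TangentSpace (𝓡 n) x)]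
    [IsContMDiffRiemannianBundle (𝓡 n) ∞ (EuclideanSpace ℝ (Fin n))
      (fun x : M => TangentSpace (𝓡 n) x)]
    (J : Set ℝ) (hJ : J.OrdConnected) (hJ' : J.Nontrivial)
    (u : ℝ → (x : M) → TangentSpace (𝓡 n) x) (hu : EulerArnold.IsSmoothCurve J u) :
    (EulerArnold.EulerArnoldEquation EulerArnold.h1Inner J u ↔ EulerArnold.GradientEquation J u) ∧
    (EulerArnold.GradientEquation J u ↔
      EulerArnold.DensityEquation J u (fun t => EulerArnold.divergence (u t))) ∧
    (∀ γ : ℝ → M, n = 1 → EulerArnold.IsArcLengthParam n γ →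
      (EulerArnold.EulerArnoldEquation EulerArnold.h1Inner J u ↔
        EulerArnold.HunterSaxtonEquation J (fun t => EulerArnold.componentAlong γ (u t)))) := by
  refine ⟨(EulerArnold.eulerArnoldEquation_iff hJ hJ' hu).trans
    (EulerArnold.gradientEquation_iff hJ hJ' hu).symm,
    (EulerArnold.gradientEquation_iff hJ hJ' hu).trans
      (EulerArnold.densityEquation_iff hJ hJ' hu).symm, ?_⟩
  intro γ hn hγ
  subst hn
  exact hγ.eulerArnoldEquation_iff hJ hJ' hu
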